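/- All vector spaces and algebras are over $\mathbb{C}$. Let $G$ be a finite group, $V$ a finite-dimensional representation of $G$, $u\in G$ a central element with $u^2=1$ acting on $V$ by $-1$, and $B\in S^2V$ a symmetric tensor in $V\otimes V$. The Hopf algebra $A(G,V,u,B)$ is defined as follows. Let $H=\mathbb{C}[G]\ltimes\Lambda V$ (with $g v g^{-1}=g\cdot v$), a Hopf superalgebra in which $G$ is even and grouplike and the elements $v\in V$ are odd with $\Delta(v)=v\otimes 1+1\otimes v$. Let $J=e^{B}$ in the super tensor square of $H$, put $\Delta^J(x)=J^{-1}\Delta(x)J$, and, for $x$ of parity $p(x)\in\{0,1\}$, write $\Delta^J(x)=\Delta_0(x)+\Delta_1(x)$ with $\Delta_i(x)\in H\otimes H_i$, where $H_0$ and $H_1$ are the even and the odd part of $H$. Then $A(G,V,u,B)$ is the algebra $H$, with the counit $\varepsilon(g)=1$, $\varepsilon(v)=0$ and the comultiplication $x\mapsto \Delta_0(x)-(-1)^{p(x)}(u\otimes 1)\Delta_1(x)$; it is an ordinary Hopf algebra. **Proposition.** Let $A_1=A(G_1,V_1,u_1,B_1)$ and $A_2=A(G_2,V_2,u_2,B_2)$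 with $V_1\neq 0$ and $V_2\ne 0$. Then $A_1$ and $A_2$ are isomorphic as Hopf algebras if and only if there exist a group isomorphism $\phi:G_1\to G_2$ with $\phi(u_1)=u_2$ and an isomorphism $\eta:V_1\to\phi^*V_2$ of representations of $G_1$ (that is, a linear isomorphism $\eta:V_1\to V_2$ with $\eta(g\cdot v)=\phi(g)\cdot\eta(v)$) such that $(\eta\otimes\eta)(B_1)-B_2\in (S^2V_2)^{G_2}$, the space of $G_2$-invariant symmetric tensors. -/

import Mathlib

open scoped TensorProduct

noncomputable section

/-- The exponential `e^x = ∑ xⁿ / n!` of a nilpotent element `x` of a complex algebra; the sum runs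
over `n < k`, where `k` is the least exponent with `x ^ k = 0`. -/
def nilExp {R : Type*} [Ring R] [Algebra ℂ R] (x : R) : R :=
  ∑ n ∈ Finset.range (nilpotencyClass x), (n.factorial : ℂ)⁻¹ • x ^ n

theorem nilExp_eq_exp {R : Type*} [Ring R] [Algebra ℂ R] (m : Module ℚ R) (x : R) :
    nilExp x = IsNilpotent.exp x := by
  have h : ∀ (q : ℚ) (y : R), q • y = (q : ℂ) • y := fun q y =>
    (ratCast_smul_eq ℂ ℚ q y).symm ▸ by simp
  simp only [nilExp, IsNilpotent.exp, h]
  simp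

theorem nilExp_eq_sum {R : Type*} [Ring R] [Algebra ℂ R] {x : R} {k : ℕ} (h : x ^ k = 0) :
    nilExp x = ∑ n ∈ Finset.range k, (n.factorial : ℂ)⁻¹ • x ^ n := by
  refine Finset.sum_subset (Finset.range_mono (Nat.sInf_le h)) fun n _ hn => ?_
  rw [pow_eq_zero_of_le (not_lt.1 fun h' => hn (Finset.mem_range.2 h'))
    (pow_nilpotencyClass ⟨k, h⟩), smul_zero]

theorem nilExp_semiconj {R : Type*} [Ring R] [Algebra ℂ R] {a x y : R} (h : SemiconjBy a x y)
    (hx : IsNilpotent x) (hy : IsNilpotent y) : SemiconjBy a (nilExp x) (nilExp y) := by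
  obtain ⟨k, hk⟩ := hx
  obtain ⟨l, hl⟩ := hy
  rw [nilExp_eq_sum (pow_eq_zero_of_le (le_max_left k l) hk),
    nilExp_eq_sum (pow_eq_zero_of_le (le_max_right k l) hl), SemiconjBy, Finset.mul_sum,
    Finset.sum_mul]
  refine Finset.sum_congr rfl fun n _ => ?_
  rw [mul_smul_comm, smul_mul_assoc, (h.pow_right n).eq]

theorem nilExp_zero {R : Type*} [Ring R] [Algebra ℂ R] : nilExp (0 : R) = 1 := by
  let m : Module ℚ R := Module.compHom R (algebraMap ℚ ℂ)
  rw [nilExp_eq_exp m, IsNilpotent.exp_zero]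

theorem nilExp_add {R : Type*} [Ring R] [Algebra ℂ R] {x y : R} (h : Commute x y)
    (hx : IsNilpotent x) (hy : IsNilpotent y) : nilExp (x + y) = nilExp x * nilExp y := by
  let m : Module ℚ R := Module.compHom R (algebraMap ℚ ℂ)
  simp only [nilExp_eq_exp m]
  exact IsNilpotent.exp_add_of_commute h hx hy

theorem nilExp_mul_neg {R : Type*} [Ring R] [Algebra ℂ R] {x : R} (hx : IsNilpotent x) :
    nilExp x * nilExp (-x) = 1 := by
  rw [← nilExp_add (Commute.neg_right rfl) hx hx.neg, add_neg_cancel, nilExp_zero]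

theorem nilExp_neg_mul {R : Type*} [Ring R] [Algebra ℂ R] {x : R} (hx : IsNilpotent x) :
    nilExp (-x) * nilExp x = 1 := by
  rw [← nilExp_add (Commute.neg_left rfl) hx.neg hx, neg_add_cancel, nilExp_zero]

theorem map_nilExp {R S : Type*} [Ring R] [Algebra ℂ R] [Ring S] [Algebra ℂ S] (f : R →ₐ[ℂ] S)
    {x : R} (hx : IsNilpotent x) : f (nilExp x) = nilExp (f x) := by
  let m : Module ℚ R := Module.compHom R (algebraMap ℚ ℂ)
  let m' : Module ℚ S := Module.compHom S (algebraMap ℚ ℂ)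
  rw [nilExp_eq_exp m, nilExp_eq_exp m', IsNilpotent.map_exp hx]

/-- The space `S²V` of symmetric `2`-tensors, as a subspace of `V ⊗ V`. -/
def symTensors (V : Type*) [AddCommGroup V] [Module ℂ V] : Submodule ℂ (V ⊗[ℂ] V) where
  carrier := {t | TensorProduct.comm ℂ V V t = t}
  add_mem' {s t} hs ht := by
    simp only [Set.mem_ofPred_eq] at hs ht ⊢
    rw [map_add, hs, ht]
  zero_mem' := map_zero _
  smul_mem' c t ht := by
    simp only [Set.mem_ofPred_eq] at ht ⊢
    rw [map_smul, ht]

/-- The space `(S²V)^G` of `G`-invariant symmetric `2`-tensors. -/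
def symInvariants {G V : Type*} [Group G] [AddCommGroup V] [Module ℂ V]
    (ρ : Representation ℂ G V) : Submodule ℂ (V ⊗[ℂ] V) where
  carrier := {t | t ∈ symTensors V ∧ ∀ g, TensorProduct.map (ρ g) (ρ g) t = t}
  add_mem' {s t} hs ht :=
    ⟨add_mem hs.1 ht.1, fun g => by rw [map_add, hs.2 g, ht.2 g]⟩
  zero_mem' := ⟨zero_mem _, fun _ => map_zero _⟩
  smul_mem' c t ht := ⟨Submodule.smul_mem _ c ht.1, fun g => by rw [map_smul, ht.2 g]⟩

/-- The data `(G, V, u, B)`: a representation `V` of `G`, a central element `u` with `u² = 1` acting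
on `V` by `-1`, and a symmetric tensor `B ∈ S²V`. -/
structure TwistDatum (G V : Type*) [Group G] [AddCommGroup V] [Module ℂ V] where
  /-- the action of `G` on `V` -/
  ρ : Representation ℂ G V
  /-- the distinguished central element -/
  u : G
  u_central : u ∈ Subgroup.center G
  u_sq : u ^ 2 = 1
  ρ_u : ∀ v : V, ρ u v = -v
  /-- the symmetric tensor -/
  B : V ⊗[ℂ] V
  B_mem : B ∈ symTensors V

namespace TwistDatum

variable {G V : Type*} [Group G] [AddCommGroup V] [Module ℂ V] (D : TwistDatum G V)

/-- The exterior algebra `ΛV`, as a type that remembers the action of `G`. -/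
def Ext (_D : TwistDatum G V) : Type _ := ExteriorAlgebra ℂ V

instance : Ring D.Ext := inferInstanceAs (Ring (ExteriorAlgebra ℂ V))

instance : Algebra ℂ D.Ext := inferInstanceAs (Algebra ℂ (ExteriorAlgebra ℂ V))

/-- `G` acts on `ΛV` by the algebra automorphisms that extend its action on `V`. -/
def extMap (g : G) : D.Ext →ₐ[ℂ] D.Ext := ExteriorAlgebra.map (D.ρ g)

theorem extMap_one : D.extMap 1 = AlgHom.id ℂ _ := by
  simp only [extMap, map_one]
  exact ExteriorAlgebra.map_id

theorem extMap_mul (g h : G) : D.extMap (g * h) = (D.extMap g).comp (D.extMap h) := by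
  simp only [extMap, map_mul]
  exact (ExteriorAlgebra.map_comp_map _ _).symm

instance : MulSemiringAction G D.Ext where
  smul g x := D.extMap g x
  one_smul x := congrArg (fun f => f x) D.extMap_one
  mul_smul g h x := congrArg (fun f => f x) (D.extMap_mul g h)
  smul_zero g := map_zero (D.extMap g)
  smul_add g := map_add (D.extMap g)
  smul_one g := map_one (D.extMap g)
  smul_mul g := map_mul (D.extMap g)

theorem smul_ext_def (g : G) (x : D.Ext) : g • x = D.extMap g x := rfl

instance : SMulCommClass G ℂ D.Ext where
  smul_comm g c x := map_smul (D.extMap g) c x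

/-- The algebra `ℂ[G ⋉ V] = ℂ[G] ⋉ ΛV`, the smash product of `G` with `ΛV`: the elements are the
formal sums `∑ α_g g` with `α_g ∈ ΛV`, and `g α = (g • α) g`. -/
def Alg : Type _ := SkewMonoidAlgebra D.Ext G

instance : Ring D.Alg := inferInstanceAs (Ring (SkewMonoidAlgebra D.Ext G))

instance : Algebra ℂ D.Alg := inferInstanceAs (Algebra ℂ (SkewMonoidAlgebra D.Ext G))

/-- The element `g` of `ℂ[G] ⋉ ΛV`. -/
def gr : G →* D.Alg := SkewMonoidAlgebra.of D.Ext G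

/-- The inclusion of `ΛV` in `ℂ[G] ⋉ ΛV`. -/
def ext : D.Ext →ₐ[ℂ] D.Alg where
  __ := SkewMonoidAlgebra.singleOneRingHom (k := D.Ext) (G := G)
  commutes' _ := rfl

/-- The inclusion of `V` in `ΛV`. -/
def extι : V →ₗ[ℂ] D.Ext := ExteriorAlgebra.ι ℂ

theorem smul_extι (g : G) (v : V) : g • D.extι v = D.extι (D.ρ g v) :=
  ExteriorAlgebra.map_apply_ι _ _

/-- The inclusion of `V` in `ℂ[G] ⋉ ΛV`. -/
def vec : V →ₗ[ℂ] D.Alg := D.ext.toLinearMap ∘ₗ D.extι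

theorem single_eq (g : G) (a : D.Ext) :
    (SkewMonoidAlgebra.single g a : D.Alg) = D.ext a * D.gr g := by
  refine Eq.trans ?_ (SkewMonoidAlgebra.single_mul_single (a₁ := 1) (b₁ := a) (b₂ := 1)).symm
  rw [one_mul, one_smul, mul_one]

theorem gr_mul_ext (g : G) (a : D.Ext) : D.gr g * D.ext a = D.ext (g • a) * D.gr g := by
  refine (SkewMonoidAlgebra.single_mul_single (a₁ := g) (b₁ := (1 : D.Ext)) (a₂ := 1)).trans
    (Eq.trans ?_ (SkewMonoidAlgebra.single_mul_single (a₁ := 1) (b₂ := (1 : D.Ext))).symm)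
  rw [one_mul, one_smul, mul_one, mul_one, one_mul]

theorem gr_mul_vec (g : G) (v : V) : D.gr g * D.vec v = D.vec (D.ρ g v) * D.gr g := by
  show D.gr g * D.ext (D.extι v) = D.ext (D.extι (D.ρ g v)) * D.gr g
  rw [gr_mul_ext, smul_extι]

theorem vec_sq (v : V) : D.vec v * D.vec v = 0 := by
  show D.ext _ * D.ext _ = 0
  rw [← map_mul]
  exact (congrArg D.ext (ExteriorAlgebra.ι_sq_zero v)).trans (map_zero _)

theorem vec_mul_vec (v w : V) : D.vec v * D.vec w = -(D.vec w * D.vec v) := by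
  have h := D.vec_sq (v + w)
  rw [map_add, add_mul, mul_add, mul_add, D.vec_sq, D.vec_sq, zero_add, add_zero] at h
  exact eq_neg_of_add_eq_zero_left h

/-- The algebra `ℂ[G] ⋉ ΛV` is generated by `G` and `V`. -/
theorem alg_induction {P : D.Alg → Prop} (hc : ∀ c : ℂ, P (algebraMap ℂ D.Alg c))
    (hg : ∀ g, P (D.gr g)) (hv : ∀ v, P (D.vec v)) (hadd : ∀ x y, P x → P y → P (x + y))
    (hmul : ∀ x y, P x → P y → P (x * y)) (x : D.Alg) : P x := by
  have hext : ∀ a : ExteriorAlgebra ℂ V, P (D.ext a) := by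
    intro a
    induction a using ExteriorAlgebra.induction with
    | algebraMap r => exact (D.ext.commutes r).symm ▸ hc r
    | ι v => exact hv v
    | mul a b ha hb => exact (map_mul D.ext a b).symm ▸ hmul _ _ ha hb
    | add a b ha hb => exact (map_add D.ext a b).symm ▸ hadd _ _ ha hb
  induction x using SkewMonoidAlgebra.induction_on with
  | zero => exact (map_zero (algebraMap ℂ D.Alg)) ▸ hc 0
  | single g a => rw [single_eq]; exact hmul _ _ (hext a) (hg g)
  | add x y hx hy => exact hadd _ _ hx hy

theorem algHom_ext {C : Type*} [Ring C] [Algebra ℂ C] {f f' : D.Alg →ₐ[ℂ] C}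
    (hg : ∀ g, f (D.gr g) = f' (D.gr g)) (hv : ∀ v, f (D.vec v) = f' (D.vec v)) : f = f' := by
  ext1 x
  induction x using D.alg_induction with
  | hc c => rw [AlgHom.commutes, AlgHom.commutes]
  | hg g => exact hg g
  | hv v => exact hv v
  | hadd x y hx hy => rw [map_add, map_add, hx, hy]
  | hmul x y hx hy => rw [map_mul, map_mul, hx, hy]

/-- The universal property of `ℂ[G] ⋉ ΛV`. -/
def lift {C : Type*} [Ring C] [Algebra ℂ C] (γ : G →* C) (f : V →ₗ[ℂ] C)
    (hf : ∀ v, f v * f v = 0) (h : ∀ g v, γ g * f v = f (D.ρ g v) * γ g) : D.Alg →ₐ[ℂ] C :=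
  SkewMonoidAlgebra.liftNCAlgHom (A := D.Ext) (ExteriorAlgebra.lift ℂ ⟨f, hf⟩) γ (by
    intro a g
    revert a
    show ∀ a : ExteriorAlgebra ℂ V, (ExteriorAlgebra.lift ℂ ⟨f, hf⟩) (ExteriorAlgebra.map (D.ρ g) a)
      * γ g = γ g * (ExteriorAlgebra.lift ℂ ⟨f, hf⟩) a
    intro a
    induction a using ExteriorAlgebra.induction with
    | algebraMap r => rw [AlgHom.commutes, AlgHom.commutes]; exact Algebra.commutes _ _
    | ι v =>
      rw [ExteriorAlgebra.map_apply_ι, ExteriorAlgebra.lift_ι_apply, ExteriorAlgebra.lift_ι_apply]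
      exact (h g v).symm
    | mul a b ha hb => rw [map_mul, map_mul, map_mul, mul_assoc, hb, ← mul_assoc, ha, mul_assoc]
    | add a b ha hb => rw [map_add, map_add, map_add, add_mul, ha, hb, mul_add])

theorem lift_gr {C : Type*} [Ring C] [Algebra ℂ C] (γ : G →* C) (f : V →ₗ[ℂ] C)
    (hf : ∀ v, f v * f v = 0) (h : ∀ g v, γ g * f v = f (D.ρ g v) * γ g) (g : G) :
    D.lift γ f hf h (D.gr g) = γ g := by
  refine (SkewMonoidAlgebra.liftNC_single _ _ g (1 : D.Ext)).trans ?_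
  exact (congrArg (· * γ g) (map_one (ExteriorAlgebra.lift ℂ ⟨f, hf⟩))).trans (one_mul _)

theorem lift_vec {C : Type*} [Ring C] [Algebra ℂ C] (γ : G →* C) (f : V →ₗ[ℂ] C)
    (hf : ∀ v, f v * f v = 0) (h : ∀ g v, γ g * f v = f (D.ρ g v) * γ g) (v : V) :
    D.lift γ f hf h (D.vec v) = f v := by
  refine (SkewMonoidAlgebra.liftNC_single _ _ (1 : G) (ExteriorAlgebra.ι ℂ v : D.Ext)).trans ?_
  rw [map_one, mul_one]
  exact ExteriorAlgebra.lift_ι_apply ℂ f hf v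

/-- The parity automorphism of `ℂ[G] ⋉ ΛV`: identity on `G` and `-1` on `V`. -/
def parity : D.Alg →ₐ[ℂ] D.Alg :=
  D.lift D.gr (-D.vec)
    (fun v => by rw [LinearMap.neg_apply, neg_mul_neg, vec_sq])
    (fun g v => by simp only [LinearMap.neg_apply, mul_neg, neg_mul, gr_mul_vec])

theorem parity_gr (g : G) : D.parity (D.gr g) = D.gr g := D.lift_gr _ _ _ _ g

theorem parity_vec (v : V) : D.parity (D.vec v) = -D.vec v := D.lift_vec _ _ _ _ v

theorem parity_parity (x : D.Alg) : D.parity (D.parity x) = x := by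
  have : D.parity.comp D.parity = AlgHom.id ℂ _ :=
    D.algHom_ext (fun g => by simp [parity_gr]) (fun v => by simp [parity_vec])
  exact congrArg (fun f => f x) this

/-- The `ℤ/2`-grading of the superalgebra `ℂ[G] ⋉ ΛV`: `G` is even and `V` is odd, that is, the
part of degree `i` is the eigenspace of the parity automorphism with eigenvalue `(-1)^i`. -/
def grading (i : ZMod 2) : Submodule ℂ D.Alg :=
  LinearMap.ker (D.parity.toLinearMap - ((-1 : ℂ) ^ i.val) • LinearMap.id)

theorem mem_grading_zero {x : D.Alg} : x ∈ D.grading 0 ↔ D.parity x = x := by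
  simp [grading, sub_eq_zero]

theorem mem_grading_one {x : D.Alg} : x ∈ D.grading 1 ↔ D.parity x = -x := by
  simp [grading, ZMod.val_one, add_eq_zero_iff_eq_neg]

theorem gr_mem (g : G) : D.gr g ∈ D.grading 0 := D.mem_grading_zero.2 (D.parity_gr g)

theorem vec_mem (v : V) : D.vec v ∈ D.grading 1 := D.mem_grading_one.2 (D.parity_vec v)

/-- The even part of an element. -/
def evenPart : D.Alg →ₗ[ℂ] D.grading 0 :=
  LinearMap.codRestrict _ ((2⁻¹ : ℂ) • (LinearMap.id + D.parity.toLinearMap)) fun x =>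
    D.mem_grading_zero.2 (by simp [parity_parity, add_comm])

/-- The odd part of an element. -/
def oddPart : D.Alg →ₗ[ℂ] D.grading 1 :=
  LinearMap.codRestrict _ ((2⁻¹ : ℂ) • (LinearMap.id - D.parity.toLinearMap)) fun x =>
    D.mem_grading_one.2 (by simp [parity_parity, ← smul_neg])

theorem evenPart_add_oddPart (x : D.Alg) : (D.evenPart x : D.Alg) + D.oddPart x = x := by
  have h : (D.evenPart x : D.Alg) + D.oddPart x =
      (2⁻¹ : ℂ) • (x + D.parity x) + (2⁻¹ : ℂ) • (x - D.parity x) := rfl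
  rw [h, ← smul_add, add_add_sub_cancel, ← two_smul ℂ x, smul_smul, inv_mul_cancel₀ two_ne_zero,
    one_smul]

theorem evenPart_zero (x : D.grading 0) : D.evenPart x = x := by
  apply Subtype.ext
  have h : (D.evenPart x : D.Alg) = (2⁻¹ : ℂ) • ((x : D.Alg) + D.parity x) := rfl
  rw [h, D.mem_grading_zero.1 x.2, ← two_smul ℂ (x : D.Alg), smul_smul,
    inv_mul_cancel₀ two_ne_zero, one_smul]

theorem evenPart_one (x : D.grading 1) : D.evenPart x = 0 := by
  apply Subtype.ext
  have h : (D.evenPart x : D.Alg) = (2⁻¹ : ℂ) • ((x : D.Alg) + D.parity x) := rfl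
  rw [h, D.mem_grading_one.1 x.2, add_neg_cancel, smul_zero]; rfl

theorem oddPart_zero (x : D.grading 0) : D.oddPart x = 0 := by
  apply Subtype.ext
  have h : (D.oddPart x : D.Alg) = (2⁻¹ : ℂ) • ((x : D.Alg) - D.parity x) := rfl
  rw [h, D.mem_grading_zero.1 x.2, sub_self, smul_zero]; rfl

theorem oddPart_one (x : D.grading 1) : D.oddPart x = x := by
  apply Subtype.ext
  have h : (D.oddPart x : D.Alg) = (2⁻¹ : ℂ) • ((x : D.Alg) - D.parity x) := rfl
  rw [h, D.mem_grading_one.1 x.2, sub_neg_eq_add, ← two_smul ℂ (x : D.Alg), smul_smul,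
    inv_mul_cancel₀ two_ne_zero, one_smul]

instance : SetLike.GradedMonoid D.grading where
  one_mem := D.mem_grading_zero.2 (map_one _)
  mul_mem i j x y hx hy := by
    fin_cases i <;> fin_cases j
    · exact D.mem_grading_zero.2
        (by rw [map_mul, D.mem_grading_zero.1 hx, D.mem_grading_zero.1 hy])
    · exact D.mem_grading_one.2
        (by rw [map_mul, D.mem_grading_zero.1 hx, D.mem_grading_one.1 hy, mul_neg])
    · exact D.mem_grading_one.2
        (by rw [map_mul, D.mem_grading_one.1 hx, D.mem_grading_zero.1 hy, neg_mul])
    · exact D.mem_grading_zero.2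
        (by rw [map_mul, D.mem_grading_one.1 hx, D.mem_grading_one.1 hy, neg_mul_neg])

instance : DirectSum.Decomposition D.grading where
  decompose' x := DirectSum.of (fun i => D.grading i) 0 (D.evenPart x) +
    DirectSum.of (fun i => D.grading i) 1 (D.oddPart x)
  left_inv x := by
    rw [map_add, DirectSum.coeAddMonoidHom_of, DirectSum.coeAddMonoidHom_of, evenPart_add_oddPart]
  right_inv x := by
    induction x using DirectSum.induction_on with
    | zero => simp
    | of i x =>
      rw [DirectSum.coeAddMonoidHom_of]
      fin_cases i
      · exact (congrArg₂ (· + ·) (congrArg _ (D.evenPart_zero x))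
          (congrArg _ (D.oddPart_zero x))).trans
          (by rw [map_zero, add_zero]; rfl)
      · exact (congrArg₂ (· + ·) (congrArg _ (D.evenPart_one x))
          (congrArg _ (D.oddPart_one x))).trans
          (by rw [map_zero, zero_add]; rfl)
    | add x y hx hy =>
      simp only [map_add] at hx hy ⊢
      rw [← hx, ← hy, add_add_add_comm]
      simp only [hx, hy]

instance : GradedAlgebra D.grading where

/-- The tensor square of `ℂ[G] ⋉ ΛV` as a superalgebra:
`(x ⊗ y) (x' ⊗ y') = (-1)^(p(y) p(x')) x x' ⊗ y y'` for `y`, `x'` homogeneous. -/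
abbrev SuperSq : Type _ := GradedTensorProduct ℂ D.grading D.grading

/-- The element `x ⊗ y` of the super tensor square. -/
abbrev stmul (x y : D.Alg) : D.SuperSq := GradedTensorProduct.of ℂ D.grading D.grading (x ⊗ₜ[ℂ] y)

theorem stmul_mul_even (x x' y y' : D.Alg) (h : y ∈ D.grading 0) :
    D.stmul x y * D.stmul x' y' = D.stmul (x * x') (y * y') := by
  have hc := D.evenPart_add_oddPart x'
  rw [← hc]
  simp only [stmul, TensorProduct.add_tmul, map_add, mul_add]
  congr 1
  · exact GradedTensorProduct.tmul_zero_coe_mul_coe_tmul (R := ℂ) (𝒜 := D.grading) (ℬ := D.grading)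
      x ⟨y, h⟩ (D.evenPart x') y'
  · exact GradedTensorProduct.tmul_zero_coe_mul_coe_tmul (R := ℂ) (𝒜 := D.grading) (ℬ := D.grading)
      x ⟨y, h⟩ (D.oddPart x') y'

theorem stmul_mul_even' (x x' y y' : D.Alg) (h : x' ∈ D.grading 0) :
    D.stmul x y * D.stmul x' y' = D.stmul (x * x') (y * y') := by
  have hc := D.evenPart_add_oddPart y
  rw [← hc]
  simp only [stmul, TensorProduct.tmul_add, map_add, add_mul]
  congr 1
  · exact GradedTensorProduct.tmul_coe_mul_zero_coe_tmul (R := ℂ) (𝒜 := D.grading) (ℬ := D.grading)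
      x (D.evenPart y) ⟨x', h⟩ y'
  · exact GradedTensorProduct.tmul_coe_mul_zero_coe_tmul (R := ℂ) (𝒜 := D.grading) (ℬ := D.grading)
      x (D.oddPart y) ⟨x', h⟩ y'

theorem stmul_mul_odd (x x' y y' : D.Alg) (h : y ∈ D.grading 1) (h' : x' ∈ D.grading 1) :
    D.stmul x y * D.stmul x' y' = -D.stmul (x * x') (y * y') := by
  refine (GradedTensorProduct.tmul_coe_mul_coe_tmul (R := ℂ) (𝒜 := D.grading) (ℬ := D.grading)
      x ⟨y, h⟩ ⟨x', h'⟩ y').trans ?_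
  have : ((-1 : ℤˣ) ^ ((1 : ZMod 2) * 1)) = -1 := by decide
  rw [this, Units.neg_smul, one_smul]

/-- The comultiplication of the Hopf superalgebra `ℂ[G] ⋉ ΛV`: `Δ(g) = g ⊗ g` and
`Δ(v) = v ⊗ 1 + 1 ⊗ v`. -/
def superComul : D.Alg →ₐ[ℂ] D.SuperSq :=
  D.lift
    { toFun := fun g => D.stmul (D.gr g) (D.gr g)
      map_one' := by rw [map_one]; rfl
      map_mul' := fun g h => by rw [stmul_mul_even _ _ _ _ _ (D.gr_mem g), map_mul] }
    { toFun := fun v => D.stmul (D.vec v) 1 + D.stmul 1 (D.vec v)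
      map_add' := fun v w => by
        simp only [stmul, map_add, TensorProduct.add_tmul, TensorProduct.tmul_add]; abel
      map_smul' := fun c v => by
        simp only [stmul, map_smul, ← TensorProduct.smul_tmul', TensorProduct.tmul_smul, smul_add,
          RingHom.id_apply] }
    (fun v => by
      show (D.stmul (D.vec v) 1 + D.stmul 1 (D.vec v)) *
        (D.stmul (D.vec v) 1 + D.stmul 1 (D.vec v)) = 0
      have h1 : (1 : D.Alg) ∈ D.grading 0 := D.mem_grading_zero.2 (map_one _)
      rw [add_mul, mul_add, mul_add, stmul_mul_even _ _ _ _ _ h1, stmul_mul_even _ _ _ _ _ h1,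
        stmul_mul_odd _ _ _ _ _ (D.vec_mem v) (D.vec_mem v), stmul_mul_even' _ _ _ _ _ h1]
      simp [vec_sq, stmul])
    (fun g v => by
      show D.stmul (D.gr g) (D.gr g) * (D.stmul (D.vec v) 1 + D.stmul 1 (D.vec v)) =
        (D.stmul (D.vec (D.ρ g v)) 1 + D.stmul 1 (D.vec (D.ρ g v))) * D.stmul (D.gr g) (D.gr g)
      rw [mul_add, add_mul, stmul_mul_even _ _ _ _ _ (D.gr_mem g),
        stmul_mul_even _ _ _ _ _ (D.gr_mem g), stmul_mul_even' _ _ _ _ _ (D.gr_mem g),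
        stmul_mul_even' _ _ _ _ _ (D.gr_mem g)]
      simp only [gr_mul_vec, mul_one, one_mul])

theorem superComul_gr (g : G) : D.superComul (D.gr g) = D.stmul (D.gr g) (D.gr g) :=
  D.lift_gr _ _ _ _ g

theorem superComul_vec (v : V) :
    D.superComul (D.vec v) = D.stmul (D.vec v) 1 + D.stmul 1 (D.vec v) :=
  D.lift_vec _ _ _ _ v

/-- The inclusion of `V ⊗ V` in the super tensor square of `ℂ[G] ⋉ ΛV`. -/
def superTens : V ⊗[ℂ] V →ₗ[ℂ] D.SuperSq :=
  (GradedTensorProduct.of ℂ D.grading D.grading).toLinearMap ∘ₗ TensorProduct.map D.vec D.vec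

theorem superTens_tmul (v w : V) : D.superTens (v ⊗ₜ w) = D.stmul (D.vec v) (D.vec w) := rfl

theorem commute_of_tmul {R : Type*} [Ring R] (f f' : V ⊗[ℂ] V → R)
    (h0 : f 0 = 0) (h0' : f' 0 = 0) (hadd : ∀ s t, f (s + t) = f s + f t)
    (hadd' : ∀ s t, f' (s + t) = f' s + f' t)
    (h : ∀ v w v' w', Commute (f (v ⊗ₜ w)) (f' (v' ⊗ₜ w'))) (s t : V ⊗[ℂ] V) :
    Commute (f s) (f' t) := by
  induction s with
  | zero => rw [h0]; exact Commute.zero_left _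
  | add x y hx hy => rw [hadd]; exact hx.add_left hy
  | tmul v w =>
    induction t with
    | zero => rw [h0']; exact Commute.zero_right _
    | add x y hx hy => rw [hadd']; exact hx.add_right hy
    | tmul v' w' => exact h v w v' w'

theorem isNilpotent_of_tmul {R : Type*} [Ring R] (f : V ⊗[ℂ] V → R)
    (h0 : f 0 = 0) (hadd : ∀ s t, f (s + t) = f s + f t)
    (h : ∀ v w v' w', Commute (f (v ⊗ₜ w)) (f (v' ⊗ₜ w')))
    (hsq : ∀ v w, f (v ⊗ₜ w) * f (v ⊗ₜ w) = 0) (t : V ⊗[ℂ] V) : IsNilpotent (f t) := by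
  induction t with
  | zero => rw [h0]; exact IsNilpotent.zero
  | add x y hx hy =>
    rw [hadd]; exact (commute_of_tmul f f h0 h0 hadd hadd h x y).isNilpotent_add hx hy
  | tmul v w => exact ⟨2, by rw [pow_two, hsq]⟩

theorem superTens_commute (s t : V ⊗[ℂ] V) : Commute (D.superTens s) (D.superTens t) :=
  commute_of_tmul D.superTens D.superTens (map_zero _) (map_zero _) (map_add _) (map_add _)
    (fun v w v' w' => by
    simp only [superTens_tmul, Commute, SemiconjBy]
    rw [stmul_mul_odd _ _ _ _ _ (D.vec_mem _) (D.vec_mem _),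
      stmul_mul_odd _ _ _ _ _ (D.vec_mem _) (D.vec_mem _), D.vec_mul_vec v v', D.vec_mul_vec w w']
    simp [stmul, TensorProduct.neg_tmul, TensorProduct.tmul_neg]) s t

theorem superTens_isNilpotent (t : V ⊗[ℂ] V) : IsNilpotent (D.superTens t) :=
  isNilpotent_of_tmul D.superTens (map_zero _) (map_add _)
    (fun _ _ _ _ => D.superTens_commute _ _) (fun v w => by
    rw [superTens_tmul, stmul_mul_odd _ _ _ _ _ (D.vec_mem _) (D.vec_mem _), vec_sq]
    simp [stmul]) t

/-- The twist `J = e^B`, a unit of the super tensor square of `ℂ[G] ⋉ ΛV`. -/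
def twist : (D.SuperSq)ˣ where
  val := nilExp (D.superTens D.B)
  inv := nilExp (-D.superTens D.B)
  val_inv := nilExp_mul_neg (D.superTens_isNilpotent _)
  inv_val := nilExp_neg_mul (D.superTens_isNilpotent _)

/-- Conjugation `x ↦ a⁻¹ x a` by a unit. -/
def conjHom {R : Type*} [Ring R] [Algebra ℂ R] (a : Rˣ) : R →ₐ[ℂ] R :=
  AlgHom.ofLinearMap (LinearMap.mulLeft ℂ (↑a⁻¹ : R) ∘ₗ LinearMap.mulRight ℂ (a : R))
    (by simp) (fun x y => by simp [mul_assoc])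

theorem conjHom_apply {R : Type*} [Ring R] [Algebra ℂ R] (a : Rˣ) (x : R) :
    conjHom a x = ↑a⁻¹ * x * a := by
  simp [conjHom, mul_assoc]

/-- The comultiplication `Δ^J(x) = J⁻¹ Δ(x) J` of the twisted Hopf superalgebra
`ℂ[G ⋉ V]^J`. -/
def twistedComul : D.Alg →ₐ[ℂ] D.SuperSq := (conjHom D.twist).comp D.superComul

theorem u_mul_u : D.u * D.u = 1 := by rw [← pow_two, D.u_sq]

theorem gr_u_sq : D.gr D.u * D.gr D.u = 1 := by rw [← map_mul, D.u_mul_u, map_one]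

theorem gr_u_comm (g : G) : D.gr D.u * D.gr g = D.gr g * D.gr D.u := by
  rw [← map_mul, ← map_mul, Subgroup.mem_center_iff.1 D.u_central g]

theorem gr_u_mul_vec (v : V) : D.gr D.u * D.vec v = -(D.vec v * D.gr D.u) := by
  rw [gr_mul_vec, D.ρ_u, map_neg, neg_mul]

theorem gr_u_mul (x : D.Alg) : D.gr D.u * x = D.parity x * D.gr D.u := by
  induction x using D.alg_induction with
  | hc c => rw [AlgHom.commutes]; exact (Algebra.commutes _ _).symm
  | hg g => rw [parity_gr, gr_u_comm]
  | hv v => rw [parity_vec, gr_u_mul_vec, neg_mul]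
  | hadd x y hx hy => rw [mul_add, hx, hy, map_add, add_mul]
  | hmul x y hx hy => rw [← mul_assoc, hx, mul_assoc, hy, ← mul_assoc, map_mul]

/-- The algebra map `y ↦ u^{p(y)} ⊗ y` to the ordinary tensor square. -/
def modifyRight : D.Alg →ₐ[ℂ] D.Alg ⊗[ℂ] D.Alg :=
  D.lift
    { toFun := fun g => 1 ⊗ₜ D.gr g
      map_one' := by rw [map_one]; rfl
      map_mul' := fun g h => by rw [map_mul, Algebra.TensorProduct.tmul_mul_tmul, one_mul] }
    (TensorProduct.mk ℂ D.Alg D.Alg (D.gr D.u) ∘ₗ D.vec)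
    (fun v => by simp [vec_sq])
    (fun g v => by simp [gr_mul_vec])

theorem modifyRight_gr (g : G) : D.modifyRight (D.gr g) = 1 ⊗ₜ D.gr g := D.lift_gr _ _ _ _ g

theorem modifyRight_vec (v : V) : D.modifyRight (D.vec v) = D.gr D.u ⊗ₜ D.vec v :=
  D.lift_vec _ _ _ _ v

theorem modifyRight_apply (y : D.Alg) :
    D.modifyRight y = 1 ⊗ₜ (D.evenPart y : D.Alg) + D.gr D.u ⊗ₜ (D.oddPart y : D.Alg) := by
  have he : ∀ y, (D.evenPart y : D.Alg) = (2⁻¹ : ℂ) • (y + D.parity y) := fun _ => rfl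
  have ho : ∀ y, (D.oddPart y : D.Alg) = (2⁻¹ : ℂ) • (y - D.parity y) := fun _ => rfl
  have e : ∀ x y : D.Alg, (D.evenPart (x * y) : D.Alg) =
      D.evenPart x * D.evenPart y + D.oddPart x * D.oddPart y := by
    intro x y
    simp only [he, ho, map_mul, smul_mul_smul_comm, ← smul_add, mul_add, add_mul, mul_sub, sub_mul]
    rw [show (2⁻¹ : ℂ) = 2⁻¹ * 2⁻¹ + 2⁻¹ * 2⁻¹ by norm_num, add_smul, ← smul_add]
    congr 1
    · norm_num
    · abel
  have o : ∀ x y : D.Alg, (D.oddPart (x * y) : D.Alg) =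
      D.evenPart x * D.oddPart y + D.oddPart x * D.evenPart y := by
    intro x y
    simp only [he, ho, map_mul, smul_mul_smul_comm, ← smul_add, mul_add, add_mul, mul_sub, sub_mul]
    rw [show (2⁻¹ : ℂ) = 2⁻¹ * 2⁻¹ + 2⁻¹ * 2⁻¹ by norm_num, add_smul, ← smul_add]
    congr 1
    · norm_num
    · abel
  induction y using D.alg_induction with
  | hc c =>
    have hm : algebraMap ℂ D.Alg c ∈ D.grading 0 := D.mem_grading_zero.2 (AlgHom.commutes _ _)
    rw [show D.evenPart (algebraMap ℂ D.Alg c) = ⟨_, hm⟩ from D.evenPart_zero ⟨_, hm⟩,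
      show D.oddPart (algebraMap ℂ D.Alg c) = 0 from D.oddPart_zero ⟨_, hm⟩, AlgHom.commutes]
    rw [Algebra.TensorProduct.algebraMap_apply']
    simp
  | hg g =>
    rw [show D.evenPart (D.gr g) = ⟨_, D.gr_mem g⟩ from D.evenPart_zero ⟨_, D.gr_mem g⟩,
      show D.oddPart (D.gr g) = 0 from D.oddPart_zero ⟨_, D.gr_mem g⟩, modifyRight_gr]
    simp
  | hv v =>
    rw [show D.evenPart (D.vec v) = 0 from D.evenPart_one ⟨_, D.vec_mem v⟩,
      show D.oddPart (D.vec v) = ⟨_, D.vec_mem v⟩ from D.oddPart_one ⟨_, D.vec_mem v⟩,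
      modifyRight_vec]
    simp
  | hadd x y hx hy =>
    simp only [map_add, hx, hy, Submodule.coe_add, TensorProduct.tmul_add]; abel
  | hmul x y hx hy =>
    rw [map_mul, hx, hy, e, o]
    simp only [mul_add, add_mul, Algebra.TensorProduct.tmul_mul_tmul, one_mul, mul_one, gr_u_sq,
      TensorProduct.tmul_add]
    abel

theorem modifyRight_comm ⦃i j : ZMod 2⦄ (a : D.grading i) (b : D.grading j) :
    Algebra.TensorProduct.includeLeft (S := ℂ) (a : D.Alg) * D.modifyRight b =
      (-1 : ℤˣ) ^ (j * i) •
        (D.modifyRight b * Algebra.TensorProduct.includeLeft (S := ℂ) (a : D.Alg)) := by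
  have h10 : ((-1 : ℤˣ) ^ ((1 : ZMod 2) * 0)) = 1 := by decide
  have h00 : ((-1 : ℤˣ) ^ ((0 : ZMod 2) * 0)) = 1 := by decide
  have h01 : ((-1 : ℤˣ) ^ ((0 : ZMod 2) * 1)) = 1 := by decide
  have h11 : ((-1 : ℤˣ) ^ ((1 : ZMod 2) * 1)) = -1 := by decide
  have hb0 : ∀ b : D.grading 0, D.modifyRight b = 1 ⊗ₜ (b : D.Alg) := fun b => by
    rw [modifyRight_apply, evenPart_zero, oddPart_zero]; simp
  have hb1 : ∀ b : D.grading 1, D.modifyRight b = D.gr D.u ⊗ₜ (b : D.Alg) := fun b => by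
    rw [modifyRight_apply, evenPart_one, oddPart_one]; simp
  have ha0 : ∀ a : D.grading 0, D.gr D.u * (a : D.Alg) = a * D.gr D.u := fun a => by
    rw [gr_u_mul, D.mem_grading_zero.1 a.2]
  have ha1 : ∀ a : D.grading 1, D.gr D.u * (a : D.Alg) = -(a * D.gr D.u) := fun a => by
    rw [gr_u_mul, D.mem_grading_one.1 a.2, neg_mul]
  have hz : ∀ k : ZMod 2, k = 0 ∨ k = 1 := by decide
  have hj : j = 0 ∨ j = 1 := hz j
  have hi : i = 0 ∨ i = 1 := hz i
  rcases hi with rfl | rfl <;> rcases hj with rfl | rfl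
  · rw [hb0, h00]; simp
  · rw [hb1, h10]; simp [ha0]
  · rw [hb0, h01]; simp
  · rw [hb1, h11]; simp [ha1, TensorProduct.neg_tmul]

/-- The passage from the super tensor square to the ordinary tensor square,
`x ⊗ y ↦ x u^{p(y)} ⊗ y` for `y` homogeneous of parity `p(y)`. If `z = z₀ + z₁` has parity `p`, with
`zᵢ` the component whose second factor has parity `i`, then `z` goes to
`z₀ - (-1)^p (u ⊗ 1) z₁`. -/
def modify : D.SuperSq →ₐ[ℂ] D.Alg ⊗[ℂ] D.Alg :=
  GradedTensorProduct.lift D.grading D.grading Algebra.TensorProduct.includeLeft D.modifyRight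
    D.modifyRight_comm

theorem modify_stmul (x y : D.Alg) :
    D.modify (D.stmul x y) = Algebra.TensorProduct.includeLeft (S := ℂ) x * D.modifyRight y := rfl

/-- The comultiplication of `A(G, V, u, B)`, obtained from the twisted comultiplication `Δ^J` of the
Hopf superalgebra `ℂ[G ⋉ V]^J` by modification with `u`. -/
def hopfComul : D.Alg →ₐ[ℂ] D.Alg ⊗[ℂ] D.Alg := D.modify.comp D.twistedComul

/-- The counit of `ℂ[G] ⋉ ΛV` and of `A(G, V, u, B)`: `ε(g) = 1` and `ε(v) = 0`. -/
def hopfCounit : D.Alg →ₐ[ℂ] ℂ :=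
  D.lift 1 0 (fun v => by simp) (fun g v => by simp)

/-- The antipode as an algebra map to the opposite algebra. -/
def antipodeOp : D.Alg →ₐ[ℂ] D.Algᵐᵒᵖ :=
  D.lift
    { toFun := fun g => MulOpposite.op (D.gr g⁻¹)
      map_one' := by simp
      map_mul' := fun g h => by rw [mul_inv_rev, map_mul, MulOpposite.op_mul] }
    { toFun := fun v => MulOpposite.op (-(D.gr D.u * D.vec v))
      map_add' := fun v w => by simp only [map_add, mul_add, neg_add, MulOpposite.op_add]
      map_smul' := fun c v => by
        simp only [map_smul, mul_smul_comm, ← smul_neg, MulOpposite.op_smul, RingHom.id_apply] }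
    (fun v => by
      show MulOpposite.op (-(D.gr D.u * D.vec v)) * MulOpposite.op (-(D.gr D.u * D.vec v)) = 0
      rw [← MulOpposite.op_mul, neg_mul_neg, D.gr_u_mul_vec, neg_mul_neg, ← mul_assoc,
        mul_assoc (D.vec v), D.gr_u_mul_vec, mul_neg, ← mul_assoc, vec_sq]
      simp)
    (fun g v => by
      show MulOpposite.op (D.gr g⁻¹) * MulOpposite.op (-(D.gr D.u * D.vec v)) =
        MulOpposite.op (-(D.gr D.u * D.vec (D.ρ g v))) * MulOpposite.op (D.gr g⁻¹)
      rw [← MulOpposite.op_mul, ← MulOpposite.op_mul, mul_neg, neg_mul, mul_assoc,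
        ← mul_assoc _ (D.gr D.u), ← gr_u_comm, mul_assoc, gr_mul_vec, ← Module.End.mul_apply, ← map_mul,
        inv_mul_cancel, map_one]
      rfl)

theorem antipodeOp_gr (g : G) : D.antipodeOp (D.gr g) = MulOpposite.op (D.gr g⁻¹) := by
  rw [antipodeOp, lift_gr]; rfl

theorem antipodeOp_vec (v : V) :
    D.antipodeOp (D.vec v) = MulOpposite.op (-(D.gr D.u * D.vec v)) := by
  rw [antipodeOp, lift_vec]; rfl

/-- The antipode of `A(G, V, u, B)`: the linear map, reversing products, with `S(g) = g⁻¹` and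
`S(v) = -u v`. -/
def hopfAntipode : D.Alg →ₗ[ℂ] D.Alg :=
  (MulOpposite.opLinearEquiv ℂ).symm.toLinearMap ∘ₗ D.antipodeOp.toLinearMap

theorem hopfAntipode_mul (x y : D.Alg) :
    D.hopfAntipode (x * y) = D.hopfAntipode y * D.hopfAntipode x := by
  show (D.antipodeOp (x * y)).unop = (D.antipodeOp y).unop * (D.antipodeOp x).unop
  rw [map_mul, MulOpposite.unop_mul]

theorem hopfAntipode_one : D.hopfAntipode 1 = 1 := by
  show (D.antipodeOp 1).unop = 1
  rw [map_one, MulOpposite.unop_one]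

theorem hopfAntipode_gr (g : G) : D.hopfAntipode (D.gr g) = D.gr g⁻¹ :=
  congrArg MulOpposite.unop (D.antipodeOp_gr g)

theorem hopfAntipode_vec (v : V) : D.hopfAntipode (D.vec v) = -(D.gr D.u * D.vec v) :=
  congrArg MulOpposite.unop (D.antipodeOp_vec v)

theorem hopfCounit_gr (g : G) : D.hopfCounit (D.gr g) = 1 := D.lift_gr _ _ _ _ g

theorem hopfCounit_vec (v : V) : D.hopfCounit (D.vec v) = 0 := D.lift_vec _ _ _ _ v

/-- The linear map `v ⊗ w ↦ v u ⊗ w`. -/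
def tens : V ⊗[ℂ] V →ₗ[ℂ] D.Alg ⊗[ℂ] D.Alg :=
  TensorProduct.map (LinearMap.mulRight ℂ (D.gr D.u) ∘ₗ D.vec) D.vec

theorem tens_tmul (v w : V) : D.tens (v ⊗ₜ w) = (D.vec v * D.gr D.u) ⊗ₜ D.vec w := rfl

theorem modify_superTens (t : V ⊗[ℂ] V) : D.modify (D.superTens t) = D.tens t := by
  have : D.modify.toLinearMap ∘ₗ D.superTens = D.tens := by
    refine TensorProduct.ext' fun v w => ?_
    show D.modify (D.superTens (v ⊗ₜ w)) = _
    rw [superTens_tmul, modify_stmul, modifyRight_vec, tens_tmul]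
    simp
  exact congrArg (fun f => f t) this

theorem tens_isNilpotent (t : V ⊗[ℂ] V) : IsNilpotent (D.tens t) :=
  D.modify_superTens t ▸ (D.superTens_isNilpotent t).map D.modify

theorem tens_commute (s t : V ⊗[ℂ] V) : Commute (D.tens s) (D.tens t) := by
  rw [← modify_superTens, ← modify_superTens]
  exact (D.superTens_commute s t).map D.modify

theorem hopfComul_apply (x : D.Alg) :
    D.hopfComul x = nilExp (-D.tens D.B) * D.modify (D.superComul x) * nilExp (D.tens D.B) := by
  show D.modify (conjHom D.twist (D.superComul x)) = _
  rw [conjHom_apply, map_mul, map_mul]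
  show D.modify (nilExp (-D.superTens D.B)) * _ * D.modify (nilExp (D.superTens D.B)) = _
  rw [map_nilExp _ (D.superTens_isNilpotent _), map_nilExp _ (D.superTens_isNilpotent _).neg,
    map_neg, modify_superTens]

theorem tens_commute_vec (t : V ⊗[ℂ] V) (v : V) :
    Commute (D.vec v ⊗ₜ[ℂ] (1 : D.Alg) + D.gr D.u ⊗ₜ D.vec v) (D.tens t) := by
  induction t with
  | zero => rw [map_zero]; exact Commute.zero_right _
  | add x y hx hy => rw [map_add]; exact hx.add_right hy
  | tmul v' w' =>
    rw [tens_tmul, Commute, SemiconjBy]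
    simp only [add_mul, mul_add, Algebra.TensorProduct.tmul_mul_tmul, one_mul, mul_one]
    congr 1
    · rw [mul_assoc, gr_u_mul_vec, mul_neg, ← mul_assoc, ← mul_assoc, D.vec_mul_vec v v', neg_mul]
    · rw [← mul_assoc, gr_u_mul_vec, D.vec_mul_vec v w', TensorProduct.tmul_neg, neg_mul,
        TensorProduct.neg_tmul, neg_neg]

theorem hopfComul_vec (v : V) : D.hopfComul (D.vec v) = D.vec v ⊗ₜ 1 + D.gr D.u ⊗ₜ D.vec v := by
  have h : D.modify (D.superComul (D.vec v)) = D.vec v ⊗ₜ 1 + D.gr D.u ⊗ₜ D.vec v := by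
    rw [superComul_vec, map_add, modify_stmul, modify_stmul, modifyRight_vec, map_one, map_one,
      one_mul, mul_one]
    rfl
  rw [hopfComul_apply, h, mul_assoc,
    nilExp_semiconj (D.tens_commute_vec D.B v) (D.tens_isNilpotent _) (D.tens_isNilpotent _),
    ← mul_assoc, nilExp_neg_mul (D.tens_isNilpotent _), one_mul]

theorem tens_semiconj (g : G) (t : V ⊗[ℂ] V) :
    SemiconjBy (D.gr g ⊗ₜ[ℂ] D.gr g) (D.tens (TensorProduct.map (D.ρ g⁻¹) (D.ρ g⁻¹) t))
      (D.tens t) := by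
  induction t with
  | zero => rw [map_zero, map_zero]; exact SemiconjBy.zero_right _
  | add x y hx hy => rw [map_add, map_add, map_add]; exact hx.add_right hy
  | tmul v w =>
    rw [TensorProduct.map_tmul, tens_tmul, tens_tmul, SemiconjBy]
    simp only [Algebra.TensorProduct.tmul_mul_tmul]
    rw [← mul_assoc, gr_mul_vec, gr_mul_vec, ← Module.End.mul_apply, ← Module.End.mul_apply,
      ← map_mul, mul_inv_cancel, map_one, mul_assoc, mul_assoc, gr_u_comm]
    rfl

/-- The symmetric tensor `B - g⁻¹ B`. -/
def defect (g : G) : V ⊗[ℂ] V := D.B - TensorProduct.map (D.ρ g⁻¹) (D.ρ g⁻¹) D.B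

theorem defect_mem (g : G) : D.defect g ∈ symTensors V := by
  refine sub_mem D.B_mem ?_
  show TensorProduct.comm ℂ V V _ = _
  rw [← TensorProduct.map_comm]
  exact congrArg _ D.B_mem

theorem defect_u : D.defect D.u = 0 := by
  have h : D.ρ D.u⁻¹ = -LinearMap.id := by
    rw [inv_eq_of_mul_eq_one_left D.u_mul_u]
    ext v
    exact D.ρ_u v
  rw [defect, h, sub_eq_zero]
  generalize D.B = t
  induction t with
  | zero => rw [map_zero]
  | add x y hx hy => rw [map_add, ← hx, ← hy]
  | tmul v w => simp [TensorProduct.neg_tmul, TensorProduct.tmul_neg]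

theorem hopfComul_gr (g : G) :
    D.hopfComul (D.gr g) = (D.gr g ⊗ₜ D.gr g) * nilExp (D.tens (D.defect g)) := by
  have h : D.modify (D.superComul (D.gr g)) = D.gr g ⊗ₜ D.gr g := by
    rw [superComul_gr, modify_stmul, modifyRight_gr]
    simp
  have h2 := (D.tens_semiconj g (-D.B))
  simp only [map_neg] at h2
  have h3 := nilExp_semiconj h2 (D.tens_isNilpotent _).neg (D.tens_isNilpotent _).neg
  rw [hopfComul_apply, h, ← h3, mul_assoc, ← nilExp_add (D.tens_commute _ _).neg_left
    (D.tens_isNilpotent _).neg (D.tens_isNilpotent _), defect, map_sub, neg_add_eq_sub]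

theorem hopfComul_gr_u : D.hopfComul (D.gr D.u) = D.gr D.u ⊗ₜ D.gr D.u := by
  rw [hopfComul_gr, defect_u, map_zero, nilExp_zero, mul_one]

/-- The map `v ⊗ w ↦ v u ⊗ w ⊗ 1`. -/
def tens12 : V ⊗[ℂ] V →ₗ[ℂ] D.Alg ⊗[ℂ] (D.Alg ⊗[ℂ] D.Alg) :=
  TensorProduct.map (LinearMap.mulRight ℂ (D.gr D.u) ∘ₗ D.vec)
    ((TensorProduct.mk ℂ D.Alg D.Alg).flip 1 ∘ₗ D.vec)

/-- The map `v ⊗ w ↦ v u ⊗ u ⊗ w`. -/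
def tens13 : V ⊗[ℂ] V →ₗ[ℂ] D.Alg ⊗[ℂ] (D.Alg ⊗[ℂ] D.Alg) :=
  TensorProduct.map (LinearMap.mulRight ℂ (D.gr D.u) ∘ₗ D.vec)
    (TensorProduct.mk ℂ D.Alg D.Alg (D.gr D.u) ∘ₗ D.vec)

/-- The map `v ⊗ w ↦ 1 ⊗ v u ⊗ w`. -/
def tens23 : V ⊗[ℂ] V →ₗ[ℂ] D.Alg ⊗[ℂ] (D.Alg ⊗[ℂ] D.Alg) :=
  TensorProduct.mk ℂ D.Alg (D.Alg ⊗[ℂ] D.Alg) 1 ∘ₗ D.tens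

theorem tens12_tmul (v w : V) :
    D.tens12 (v ⊗ₜ w) = (D.vec v * D.gr D.u) ⊗ₜ (D.vec w ⊗ₜ 1) := rfl

theorem tens13_tmul (v w : V) :
    D.tens13 (v ⊗ₜ w) = (D.vec v * D.gr D.u) ⊗ₜ (D.gr D.u ⊗ₜ D.vec w) := rfl

theorem tens23_tmul (v w : V) :
    D.tens23 (v ⊗ₜ w) = 1 ⊗ₜ ((D.vec v * D.gr D.u) ⊗ₜ D.vec w) := rfl

theorem vecu_mul_vecu (v w : V) :
    D.vec v * D.gr D.u * (D.vec w * D.gr D.u) = -(D.vec v * D.vec w) := by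
  rw [mul_assoc, ← mul_assoc (D.gr D.u), gr_u_mul_vec, neg_mul, mul_assoc, gr_u_sq, mul_one,
    mul_neg]

theorem vecu_mul_u (v : V) : D.vec v * D.gr D.u * D.gr D.u = D.vec v := by
  rw [mul_assoc, gr_u_sq, mul_one]

theorem u_mul_vecu (v : V) : D.gr D.u * (D.vec v * D.gr D.u) = -D.vec v := by
  rw [← mul_assoc, gr_u_mul_vec, neg_mul, vecu_mul_u]

theorem vecu_mul_vec (v w : V) :
    D.vec v * D.gr D.u * D.vec w = -(D.vec v * D.vec w * D.gr D.u) := by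
  rw [mul_assoc, gr_u_mul_vec, mul_neg, mul_assoc]

theorem tens12_commute_tens13 (s t : V ⊗[ℂ] V) : Commute (D.tens12 s) (D.tens13 t) :=
  commute_of_tmul D.tens12 D.tens13 D.tens12.map_zero D.tens13.map_zero
    D.tens12.map_add D.tens13.map_add
    (fun v w v' w' => by
    rw [tens12_tmul, tens13_tmul, Commute, SemiconjBy]
    simp only [Algebra.TensorProduct.tmul_mul_tmul, one_mul, mul_one, vecu_mul_vecu, gr_u_mul_vec]
    rw [D.vec_mul_vec v v']
    simp [TensorProduct.neg_tmul, TensorProduct.tmul_neg]) s t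

theorem tens12_commute_tens23 (s t : V ⊗[ℂ] V) : Commute (D.tens12 s) (D.tens23 t) :=
  commute_of_tmul D.tens12 D.tens23 D.tens12.map_zero D.tens23.map_zero
    D.tens12.map_add D.tens23.map_add
    (fun v w v' w' => by
    rw [tens12_tmul, tens23_tmul, Commute, SemiconjBy]
    simp only [Algebra.TensorProduct.tmul_mul_tmul, one_mul, mul_one, vecu_mul_vec, ← mul_assoc]
    rw [D.vec_mul_vec w v', neg_mul]) s t

theorem tens13_commute_tens23 (s t : V ⊗[ℂ] V) : Commute (D.tens13 s) (D.tens23 t) :=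
  commute_of_tmul D.tens13 D.tens23 D.tens13.map_zero D.tens23.map_zero
    D.tens13.map_add D.tens23.map_add
    (fun v w v' w' => by
    rw [tens13_tmul, tens23_tmul, Commute, SemiconjBy]
    simp only [Algebra.TensorProduct.tmul_mul_tmul, one_mul, mul_one, vecu_mul_u, u_mul_vecu]
    rw [D.vec_mul_vec w w']
    simp [TensorProduct.neg_tmul, TensorProduct.tmul_neg]) s t

theorem assoc_tens (t : V ⊗[ℂ] V) :
    Algebra.TensorProduct.assoc ℂ ℂ ℂ D.Alg D.Alg D.Alg (D.tens t ⊗ₜ 1) = D.tens12 t := by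
  induction t with
  | zero => simp
  | add x y hx hy => rw [map_add, TensorProduct.add_tmul, map_add, hx, hy, map_add]
  | tmul v w => rw [tens_tmul, tens12_tmul, Algebra.TensorProduct.assoc_tmul]

theorem tens12_isNilpotent (t : V ⊗[ℂ] V) : IsNilpotent (D.tens12 t) := by
  rw [← assoc_tens]
  exact ((D.tens_isNilpotent t).map
    (Algebra.TensorProduct.includeLeft (R := ℂ) (S := ℂ) (A := D.Alg ⊗[ℂ] D.Alg)
      (B := D.Alg))).map (Algebra.TensorProduct.assoc ℂ ℂ ℂ D.Alg D.Alg D.Alg)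

theorem tens23_isNilpotent (t : V ⊗[ℂ] V) : IsNilpotent (D.tens23 t) :=
  (D.tens_isNilpotent t).map (Algebra.TensorProduct.includeRight (R := ℂ) (A := D.Alg))

theorem tens13_isNilpotent (t : V ⊗[ℂ] V) : IsNilpotent (D.tens13 t) :=
  isNilpotent_of_tmul D.tens13 D.tens13.map_zero D.tens13.map_add
    (fun v w v' w' => by
    rw [tens13_tmul, tens13_tmul, Commute, SemiconjBy]
    simp only [Algebra.TensorProduct.tmul_mul_tmul, vecu_mul_vecu]
    rw [D.vec_mul_vec w w', D.vec_mul_vec v v']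
    simp [TensorProduct.neg_tmul, TensorProduct.tmul_neg]) (fun v w => by
    rw [tens13_tmul]
    simp [Algebra.TensorProduct.tmul_mul_tmul, vecu_mul_vecu, vec_sq]) t

theorem map_comul_id_tens (t : V ⊗[ℂ] V) :
    Algebra.TensorProduct.assoc ℂ ℂ ℂ D.Alg D.Alg D.Alg
      (Algebra.TensorProduct.map D.hopfComul (AlgHom.id ℂ D.Alg) (D.tens t)) =
      D.tens13 t + D.tens23 t := by
  induction t with
  | zero => simp
  | add x y hx hy => simp only [map_add, hx, hy]; abel
  | tmul v w =>
    rw [tens_tmul, tens13_tmul, tens23_tmul, Algebra.TensorProduct.map_tmul, map_mul,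
      hopfComul_vec, hopfComul_gr_u, add_mul, Algebra.TensorProduct.tmul_mul_tmul,
      Algebra.TensorProduct.tmul_mul_tmul, gr_u_sq, one_mul, TensorProduct.add_tmul, map_add]
    simp

theorem map_id_comul_tens (t : V ⊗[ℂ] V) :
    Algebra.TensorProduct.map (AlgHom.id ℂ D.Alg) D.hopfComul (D.tens t) =
      D.tens12 t + D.tens13 t := by
  induction t with
  | zero => simp
  | add x y hx hy => simp only [map_add, hx, hy]; abel
  | tmul v w =>
    rw [tens_tmul, tens12_tmul, tens13_tmul, Algebra.TensorProduct.map_tmul,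
      hopfComul_vec, TensorProduct.tmul_add]
    simp

theorem hopfComul_coassoc :
    (Algebra.TensorProduct.assoc ℂ ℂ ℂ D.Alg D.Alg D.Alg).toAlgHom.comp
      ((Algebra.TensorProduct.map D.hopfComul (AlgHom.id ℂ D.Alg)).comp D.hopfComul) =
      (Algebra.TensorProduct.map (AlgHom.id ℂ D.Alg) D.hopfComul).comp D.hopfComul := by
  refine D.algHom_ext (fun g => ?_) (fun v => ?_)
  · set Φ : (D.Alg ⊗[ℂ] D.Alg) →ₐ[ℂ] (D.Alg ⊗[ℂ] (D.Alg ⊗[ℂ] D.Alg)) :=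
      (Algebra.TensorProduct.assoc ℂ ℂ ℂ D.Alg D.Alg D.Alg).toAlgHom.comp
        (Algebra.TensorProduct.map D.hopfComul (AlgHom.id ℂ D.Alg)) with hΦ
    set Ψ := Algebra.TensorProduct.map (AlgHom.id ℂ D.Alg) D.hopfComul with hΨ
    show Φ (D.hopfComul (D.gr g)) = Ψ (D.hopfComul (D.gr g))
    have hΦt : Φ (D.tens (D.defect g)) = D.tens13 (D.defect g) + D.tens23 (D.defect g) :=
      D.map_comul_id_tens _
    have hΨt : Ψ (D.tens (D.defect g)) = D.tens12 (D.defect g) + D.tens13 (D.defect g) :=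
      D.map_id_comul_tens _
    have hΦg : Φ (D.gr g ⊗ₜ D.gr g) = (D.gr g ⊗ₜ (D.gr g ⊗ₜ D.gr g)) *
        nilExp (D.tens12 (D.defect g)) := by
      show Algebra.TensorProduct.assoc ℂ ℂ ℂ D.Alg D.Alg D.Alg
        (D.hopfComul (D.gr g) ⊗ₜ D.gr g) = _
      rw [hopfComul_gr]
      have := Algebra.TensorProduct.tmul_mul_tmul (R := ℂ) (D.gr g ⊗ₜ[ℂ] D.gr g)
        (nilExp (D.tens (D.defect g))) (D.gr g) 1
      rw [mul_one] at this
      rw [← this, map_mul, Algebra.TensorProduct.assoc_tmul]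
      congr 1
      have h := map_nilExp ((Algebra.TensorProduct.assoc ℂ ℂ ℂ D.Alg D.Alg D.Alg).toAlgHom.comp
        (Algebra.TensorProduct.includeLeft (R := ℂ) (S := ℂ) (A := D.Alg ⊗[ℂ] D.Alg)
          (B := D.Alg))) (D.tens_isNilpotent (D.defect g))
      refine Eq.trans h (congrArg nilExp ?_)
      exact D.assoc_tens _
    have hΨg : Ψ (D.gr g ⊗ₜ D.gr g) = (D.gr g ⊗ₜ (D.gr g ⊗ₜ D.gr g)) *
        nilExp (D.tens23 (D.defect g)) := by
      rw [hΨ, Algebra.TensorProduct.map_tmul, hopfComul_gr]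
      have := Algebra.TensorProduct.tmul_mul_tmul (R := ℂ) (D.gr g) 1 (D.gr g ⊗ₜ[ℂ] D.gr g)
        (nilExp (D.tens (D.defect g)))
      rw [mul_one] at this
      refine this.symm.trans ?_
      congr 1
      exact map_nilExp (Algebra.TensorProduct.includeRight (R := ℂ) (A := D.Alg)
        (B := D.Alg ⊗[ℂ] D.Alg)) (D.tens_isNilpotent (D.defect g))
    have n12 := D.tens12_isNilpotent (D.defect g)
    have n13 := D.tens13_isNilpotent (D.defect g)
    have n23 := D.tens23_isNilpotent (D.defect g)
    have c12 := D.tens12_commute_tens13 (D.defect g) (D.defect g)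
    have c23 := D.tens13_commute_tens23 (D.defect g) (D.defect g)
    have c := D.tens12_commute_tens23 (D.defect g) (D.defect g)
    rw [hopfComul_gr, map_mul, map_mul, hΦg, hΨg, map_nilExp (S := D.Alg ⊗[ℂ] (D.Alg ⊗[ℂ] D.Alg)) Φ (D.tens_isNilpotent _),
      map_nilExp (S := D.Alg ⊗[ℂ] (D.Alg ⊗[ℂ] D.Alg)) Ψ (D.tens_isNilpotent _), hΦt, hΨt]
    refine (mul_assoc (_ : D.Alg ⊗[ℂ] (D.Alg ⊗[ℂ] D.Alg)) _ _).trans ?_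
    refine Eq.trans ?_ (mul_assoc (_ : D.Alg ⊗[ℂ] (D.Alg ⊗[ℂ] D.Alg)) _ _).symm
    refine congrArg (fun z => (D.gr g ⊗ₜ (D.gr g ⊗ₜ D.gr g)) * z) ?_
    have cc : Commute (D.tens23 (D.defect g)) (D.tens12 (D.defect g) + D.tens13 (D.defect g)) :=
      SemiconjBy.add_right (R := D.Alg ⊗[ℂ] (D.Alg ⊗[ℂ] D.Alg)) c.symm c23.symm
    refine (nilExp_add (c12.add_right c) n12 (c23.isNilpotent_add n13 n23)).symm.trans (Eq.trans ?_
      (nilExp_add cc n23 (c12.isNilpotent_add n12 n13)))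
    congr 1
    abel
  · show Algebra.TensorProduct.assoc ℂ ℂ ℂ D.Alg D.Alg D.Alg
      (Algebra.TensorProduct.map D.hopfComul (AlgHom.id ℂ D.Alg) (D.hopfComul (D.vec v))) =
      Algebra.TensorProduct.map (AlgHom.id ℂ D.Alg) D.hopfComul (D.hopfComul (D.vec v))
    rw [hopfComul_vec, map_add, map_add, map_add]
    simp only [Algebra.TensorProduct.map_tmul, hopfComul_vec, hopfComul_gr_u, map_one,
      AlgHom.id_apply, TensorProduct.add_tmul, TensorProduct.tmul_add, map_add,
      Algebra.TensorProduct.assoc_tmul, Algebra.TensorProduct.one_def]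
    abel

theorem map_counit_id_tens (t : V ⊗[ℂ] V) :
    Algebra.TensorProduct.map D.hopfCounit (AlgHom.id ℂ D.Alg) (D.tens t) = 0 := by
  induction t with
  | zero => simp
  | add x y hx hy => rw [map_add, map_add, hx, hy, add_zero]
  | tmul v w => simp [tens_tmul, hopfCounit_vec]

theorem map_id_counit_tens (t : V ⊗[ℂ] V) :
    Algebra.TensorProduct.map (AlgHom.id ℂ D.Alg) D.hopfCounit (D.tens t) = 0 := by
  induction t with
  | zero => simp
  | add x y hx hy => rw [map_add, map_add, hx, hy, add_zero]
  | tmul v w => simp [tens_tmul, hopfCounit_vec]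

theorem hopfCounit_rTensor :
    (Algebra.TensorProduct.map D.hopfCounit (AlgHom.id ℂ D.Alg)).comp D.hopfComul =
      (Algebra.TensorProduct.lid ℂ D.Alg).symm.toAlgHom := by
  refine D.algHom_ext (fun g => ?_) (fun v => ?_)
  · show Algebra.TensorProduct.map D.hopfCounit (AlgHom.id ℂ D.Alg) (D.hopfComul (D.gr g)) =
      1 ⊗ₜ D.gr g
    rw [hopfComul_gr, map_mul, map_nilExp _ (D.tens_isNilpotent _), map_counit_id_tens, nilExp_zero,
      mul_one, Algebra.TensorProduct.map_tmul, hopfCounit_gr, AlgHom.id_apply]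
  · show Algebra.TensorProduct.map D.hopfCounit (AlgHom.id ℂ D.Alg) (D.hopfComul (D.vec v)) =
      1 ⊗ₜ D.vec v
    simp [hopfComul_vec, hopfCounit_vec, hopfCounit_gr]

theorem hopfCounit_lTensor :
    (Algebra.TensorProduct.map (AlgHom.id ℂ D.Alg) D.hopfCounit).comp D.hopfComul =
      (Algebra.TensorProduct.rid ℂ ℂ D.Alg).symm.toAlgHom := by
  refine D.algHom_ext (fun g => ?_) (fun v => ?_)
  · show Algebra.TensorProduct.map (AlgHom.id ℂ D.Alg) D.hopfCounit (D.hopfComul (D.gr g)) =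
      D.gr g ⊗ₜ 1
    rw [hopfComul_gr, map_mul, map_nilExp _ (D.tens_isNilpotent _), map_id_counit_tens, nilExp_zero,
      mul_one, Algebra.TensorProduct.map_tmul, hopfCounit_gr, AlgHom.id_apply]
  · show Algebra.TensorProduct.map (AlgHom.id ℂ D.Alg) D.hopfCounit (D.hopfComul (D.vec v)) =
      D.vec v ⊗ₜ 1
    simp [hopfComul_vec, hopfCounit_vec]

instance : Bialgebra ℂ D.Alg :=
  Bialgebra.ofAlgHom D.hopfComul D.hopfCounit D.hopfComul_coassoc D.hopfCounit_rTensor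
    D.hopfCounit_lTensor

theorem comul_eq (x : D.Alg) : Coalgebra.comul (R := ℂ) x = D.hopfComul x := rfl

theorem counit_eq (x : D.Alg) : Coalgebra.counit (R := ℂ) x = D.hopfCounit x := rfl

/-- The map `x ⊗ y ↦ S(x) y`. -/
def convL : D.Alg ⊗[ℂ] D.Alg →ₗ[ℂ] D.Alg :=
  LinearMap.mul' ℂ D.Alg ∘ₗ D.hopfAntipode.rTensor D.Alg

/-- The map `x ⊗ y ↦ x S(y)`. -/
def convR : D.Alg ⊗[ℂ] D.Alg →ₗ[ℂ] D.Alg :=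
  LinearMap.mul' ℂ D.Alg ∘ₗ D.hopfAntipode.lTensor D.Alg

theorem convL_tmul (x y : D.Alg) : D.convL (x ⊗ₜ y) = D.hopfAntipode x * y := rfl

theorem convR_tmul (x y : D.Alg) : D.convR (x ⊗ₜ y) = x * D.hopfAntipode y := rfl

/-- The product map `v ⊗ w ↦ v w`. -/
def prodVec : V ⊗[ℂ] V →ₗ[ℂ] D.Alg := LinearMap.mul' ℂ D.Alg ∘ₗ TensorProduct.map D.vec D.vec

theorem prodVec_eq_zero {t : V ⊗[ℂ] V} (ht : t ∈ symTensors V) : D.prodVec t = 0 := by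
  have h : ∀ s : V ⊗[ℂ] V, D.prodVec (TensorProduct.comm ℂ V V s) = -D.prodVec s := by
    intro s
    induction s with
    | zero => simp
    | add x y hx hy => rw [map_add, map_add, hx, hy, map_add, neg_add]
    | tmul v w => exact D.vec_mul_vec w v
  have h2 := h t
  rw [show TensorProduct.comm ℂ V V t = t from ht] at h2
  have h3 : (2 : ℂ) • D.prodVec t = 0 := by rw [two_smul]; nth_rw 1 [h2]; exact neg_add_cancel _
  exact (smul_eq_zero.1 h3).resolve_left two_ne_zero

theorem hopfAntipode_vec_mul_u (v : V) : D.hopfAntipode (D.vec v * D.gr D.u) = -D.vec v := by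
  rw [hopfAntipode_mul, hopfAntipode_gr, hopfAntipode_vec, mul_neg, ← mul_assoc, ← map_mul,
    inv_mul_cancel, map_one, one_mul]

theorem convL_mul_tens (z : D.Alg ⊗[ℂ] D.Alg) (c : ℂ) (hz : D.convL z = algebraMap ℂ D.Alg c)
    {t : V ⊗[ℂ] V} (ht : t ∈ symTensors V) : D.convL (z * D.tens t) = 0 := by
  have h : ∀ v w, ∀ z : D.Alg ⊗[ℂ] D.Alg,
      D.convL (z * D.tens (v ⊗ₜ w)) = -(D.vec v * D.convL z * D.vec w) := by
    intro v w z
    induction z with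
    | zero => simp
    | add x y hx hy => simp only [add_mul, map_add, hx, hy, mul_add, neg_add]
    | tmul x y =>
      rw [tens_tmul, Algebra.TensorProduct.tmul_mul_tmul, convL_tmul, convL_tmul, hopfAntipode_mul,
        hopfAntipode_vec_mul_u]
      simp only [neg_mul, mul_assoc]
  have h2 : ∀ t, D.convL (z * D.tens t) = -(c • D.prodVec t) := by
    intro t
    induction t with
    | zero => simp
    | add x y hx hy => simp only [mul_add, map_add, hx, hy, smul_add, neg_add]
    | tmul v w =>
      rw [h, hz, ← Algebra.commutes, mul_assoc, ← Algebra.smul_def]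
      rfl
  rw [h2, D.prodVec_eq_zero ht, smul_zero, neg_zero]

theorem convR_tens_mul (z : D.Alg ⊗[ℂ] D.Alg) (c : ℂ) (hz : D.convR z = algebraMap ℂ D.Alg c)
    {t : V ⊗[ℂ] V} (ht : t ∈ symTensors V) : D.convR (D.tens t * z) = 0 := by
  have h : ∀ v w, ∀ z : D.Alg ⊗[ℂ] D.Alg, D.convR (D.tens (v ⊗ₜ w) * z) =
      -(D.vec v * D.gr D.u * D.convR z * (D.gr D.u * D.vec w)) := by
    intro v w z
    induction z with
    | zero => simp
    | add x y hx hy => simp only [mul_add, map_add, hx, hy, add_mul, neg_add]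
    | tmul x y =>
      rw [tens_tmul, Algebra.TensorProduct.tmul_mul_tmul, convR_tmul, convR_tmul, hopfAntipode_mul,
        hopfAntipode_vec]
      simp only [mul_neg, mul_assoc]
  have h2 : ∀ t, D.convR (D.tens t * z) = -(c • D.prodVec t) := by
    intro t
    induction t with
    | zero => simp
    | add x y hx hy => simp only [add_mul, map_add, hx, hy, smul_add, neg_add]
    | tmul v w =>
      rw [h, hz, ← Algebra.commutes, mul_assoc, ← mul_assoc _ (D.gr D.u) (D.vec w), vecu_mul_u,
        ← Algebra.smul_def]
      rfl
  rw [h2, D.prodVec_eq_zero ht, smul_zero, neg_zero]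

theorem convL_nilExp {t : V ⊗[ℂ] V} (ht : t ∈ symTensors V) :
    D.convL (nilExp (D.tens t)) = 1 := by
  have h0 : D.convL 1 = 1 := by
    rw [Algebra.TensorProduct.one_def, convL_tmul, hopfAntipode_one, one_mul]
  have h1 : ∀ n, D.convL (D.tens t ^ (n + 1)) = 0 := by
    intro n
    induction n with
    | zero =>
      rw [pow_succ, pow_zero]
      exact D.convL_mul_tens 1 1 (by rw [h0, map_one]) ht
    | succ n ih =>
      rw [pow_succ]
      exact D.convL_mul_tens _ 0 (by rw [ih, map_zero]) ht
  obtain ⟨k, hk⟩ := D.tens_isNilpotent t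
  rw [nilExp_eq_sum (pow_eq_zero_of_le (Nat.le_succ k) hk), map_sum, Finset.sum_range_succ']
  simp [h0, h1]

theorem convR_nilExp {t : V ⊗[ℂ] V} (ht : t ∈ symTensors V) :
    D.convR (nilExp (D.tens t)) = 1 := by
  have h0 : D.convR 1 = 1 := by
    rw [Algebra.TensorProduct.one_def, convR_tmul, hopfAntipode_one, one_mul]
  have h1 : ∀ n, D.convR (D.tens t ^ (n + 1)) = 0 := by
    intro n
    induction n with
    | zero =>
      rw [zero_add, pow_one, ← mul_one (D.tens t)]
      exact D.convR_tens_mul 1 1 (by rw [h0, map_one]) ht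
    | succ n ih =>
      rw [pow_succ']
      exact D.convR_tens_mul _ 0 (by rw [ih, map_zero]) ht
  obtain ⟨k, hk⟩ := D.tens_isNilpotent t
  rw [nilExp_eq_sum (pow_eq_zero_of_le (Nat.le_succ k) hk), map_sum, Finset.sum_range_succ']
  simp [h0, h1]

theorem convL_mul (a b : D.Alg ⊗[ℂ] D.Alg) (c : ℂ) (ha : D.convL a = algebraMap ℂ D.Alg c) :
    D.convL (a * b) = c • D.convL b := by
  induction b with
  | zero => simp
  | add x y hx hy => rw [mul_add, map_add, hx, hy, map_add, smul_add]
  | tmul x y =>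
    have h : ∀ a, D.convL (a * (x ⊗ₜ y)) = D.hopfAntipode x * D.convL a * y := by
      intro a
      induction a with
      | zero => simp
      | add p q hp hq => simp only [add_mul, map_add, hp, hq, mul_add]
      | tmul p q =>
        rw [Algebra.TensorProduct.tmul_mul_tmul, convL_tmul, convL_tmul, hopfAntipode_mul]
        simp only [mul_assoc]
    rw [h, ha, ← Algebra.commutes, mul_assoc, ← Algebra.smul_def, convL_tmul]

theorem convR_mul (a b : D.Alg ⊗[ℂ] D.Alg) (c : ℂ) (hb : D.convR b = algebraMap ℂ D.Alg c) :
    D.convR (a * b) = c • D.convR a := by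
  induction a with
  | zero => simp
  | add x y hx hy => rw [add_mul, map_add, hx, hy, map_add, smul_add]
  | tmul x y =>
    have h : ∀ b, D.convR ((x ⊗ₜ y) * b) = x * D.convR b * D.hopfAntipode y := by
      intro b
      induction b with
      | zero => simp
      | add p q hp hq => simp only [mul_add, map_add, hp, hq, add_mul]
      | tmul p q =>
        rw [Algebra.TensorProduct.tmul_mul_tmul, convR_tmul, convR_tmul, hopfAntipode_mul]
        simp only [mul_assoc]
    rw [h, hb, ← Algebra.commutes, mul_assoc, ← Algebra.smul_def, convR_tmul]

theorem convL_comul (x : D.Alg) :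
    D.convL (D.hopfComul x) = algebraMap ℂ D.Alg (D.hopfCounit x) := by
  induction x using D.alg_induction with
  | hc c =>
    rw [AlgHom.commutes, AlgHom.commutes, Algebra.TensorProduct.algebraMap_apply, convL_tmul,
      mul_one, Algebra.algebraMap_eq_smul_one, map_smul, hopfAntipode_one,
      ← Algebra.algebraMap_eq_smul_one]
    rfl
  | hg g =>
    have h : ∀ z, D.convL ((D.gr g ⊗ₜ D.gr g) * z) = D.convL z := by
      intro z
      induction z with
      | zero => simp
      | add p q hp hq => rw [mul_add, map_add, hp, hq, map_add]
      | tmul p q =>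
        rw [Algebra.TensorProduct.tmul_mul_tmul, convL_tmul, convL_tmul, hopfAntipode_mul,
          hopfAntipode_gr, mul_assoc, ← mul_assoc _ (D.gr g), ← map_mul, inv_mul_cancel, map_one,
          one_mul]
    rw [hopfComul_gr, h, D.convL_nilExp (D.defect_mem g), hopfCounit_gr, map_one]
  | hv v =>
    rw [hopfComul_vec, map_add, convL_tmul, convL_tmul, hopfAntipode_vec, hopfAntipode_gr,
      inv_eq_of_mul_eq_one_left D.u_mul_u, mul_one, neg_add_cancel, hopfCounit_vec, map_zero]
  | hadd x y hx hy => simp only [map_add, hx, hy]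
  | hmul x y hx hy =>
    rw [map_mul, D.convL_mul _ _ _ hx, hy, map_mul, map_mul, Algebra.smul_def]

theorem convR_comul (x : D.Alg) :
    D.convR (D.hopfComul x) = algebraMap ℂ D.Alg (D.hopfCounit x) := by
  induction x using D.alg_induction with
  | hc c =>
    rw [AlgHom.commutes, AlgHom.commutes, Algebra.TensorProduct.algebraMap_apply, convR_tmul,
      hopfAntipode_one, mul_one]
    rfl
  | hg g =>
    have h2 := (D.tens_semiconj g (TensorProduct.map (D.ρ g) (D.ρ g) (D.defect g)))
    have h3 : TensorProduct.map (D.ρ g⁻¹) (D.ρ g⁻¹) (TensorProduct.map (D.ρ g) (D.ρ g)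
        (D.defect g)) = D.defect g := by
      rw [← LinearMap.comp_apply, ← TensorProduct.map_comp, ← Module.End.mul_eq_comp, ← map_mul,
        inv_mul_cancel, map_one]
      exact congrArg (fun f => f (D.defect g)) (TensorProduct.map_id (R := ℂ) (M := V) (N := V))
    rw [h3] at h2
    have h : ∀ z, D.convR (z * (D.gr g ⊗ₜ D.gr g)) = D.convR z := by
      intro z
      induction z with
      | zero => simp
      | add p q hp hq => rw [add_mul, map_add, hp, hq, map_add]
      | tmul p q =>
        rw [Algebra.TensorProduct.tmul_mul_tmul, convR_tmul, convR_tmul, hopfAntipode_mul,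
          hopfAntipode_gr, mul_assoc, ← mul_assoc (D.gr g), ← map_mul, mul_inv_cancel, map_one,
          one_mul]
    have hs : TensorProduct.map (D.ρ g) (D.ρ g) (D.defect g) ∈ symTensors V := by
      show TensorProduct.comm ℂ V V _ = _
      rw [← TensorProduct.map_comm]
      exact congrArg _ (D.defect_mem g)
    rw [hopfComul_gr, nilExp_semiconj h2 (D.tens_isNilpotent _) (D.tens_isNilpotent _), h,
      D.convR_nilExp hs, hopfCounit_gr, map_one]
  | hv v =>
    rw [hopfComul_vec, map_add, convR_tmul, convR_tmul, hopfAntipode_vec, hopfAntipode_one,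
      mul_one, mul_neg, ← mul_assoc, gr_u_sq, one_mul, add_neg_cancel, hopfCounit_vec, map_zero]
  | hadd x y hx hy => simp only [map_add, hx, hy]
  | hmul x y hx hy =>
    rw [map_mul, D.convR_mul _ _ _ hy, hx, map_mul, map_mul, Algebra.smul_def, Algebra.commutes]

/-- The Hopf algebra `A(G, V, u, B)`: the algebra `ℂ[G] ⋉ ΛV` with the comultiplication obtained
from that of the Hopf superalgebra `ℂ[G ⋉ V]` by the twist `e^B` and the modification by `u`. -/
instance : HopfAlgebra ℂ D.Alg where
  antipode := D.hopfAntipode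
  mul_antipode_rTensor_comul := LinearMap.ext D.convL_comul
  mul_antipode_lTensor_comul := LinearMap.ext D.convR_comul

end TwistDatum

end

/-!
Write `A = A(G, V, u, B)`. A group isomorphism `φ` and a `φ`-equivariant isomorphism `η` always give
an isomorphism of algebras `A₁ ≃ A₂` (`mapAlg`). As `Δ(g) = (g ⊗ g) e^(B - g⁻¹B)`, it respects the
comultiplications as soon as `φ(u₁) = u₂` and `(η ⊗ η)(B₁) - B₂` is invariant
(`map_mapAlg_comul`).

Conversely, let `f : A₁ → A₂` be a map of Hopf algebras. The projection `A → ℂ[G]` that kills `V` is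
a map of Hopf algebras (`toGrp`), and the image in `ℂ[G₂]` of `f(v)`, for `v ∈ V₁`, is a skew
primitive element that anticommutes with the image of `f(u₁)`; such an element is zero
(`skewPrimitive_eq_zero_of_anticommute`). So `f` induces a map of Hopf algebras `ℂ[G₁] → ℂ[G₂]`,
hence a homomorphism `φ : G₁ → G₂` (`grpPart`).

Each `A` acts on `V ⊕ ℂ`, and the orbit map of `1 ∈ ℂ` reads off the component of degree `1` of an
element of `A`, in `V` (`jet`). Put `η(v) = jet(f(v))` (`linearPart`). The element `v g` has degree
`u g` for the left coaction of `ℂ[G]` and degree `g` for the right one (`toGrp_jet_comul`).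
Comparing the two degrees of `f(v)` gives `φ(u₁) = u₂` (`grpPart_u`); doing so for `f(g)` gives
`jet(f(g)) = 0` (`jet_map_gr`), since `u₂ ≠ 1`. Therefore `jet ∘ f = η ∘ jet`, so that `φ` and `η`
are functorial in `f`, and they are isomorphisms if `f` is one.

Finally, let `A ⊗ A` act on `(V ⊕ ℂ) ⊗ (V ⊕ ℂ)` and consider the component in `V ⊗ V` of
`Δ(x) (1 ⊗ 1)`. For `x ∈ ΛV` it is antisymmetric (`comm_fstPair_comul_ext`), so its symmetric part
depends only on the image of `x` in `ℂ[G]` (`symJet_eq_of_toGrp`). For `x = f(g)` it is therefore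
the same as for `φ(g)`, namely `φ(g) B₂ - B₂` up to a factor `2`, while `Δ(f(g)) = (f ⊗ f)(Δ(g))`
makes it `φ(g) C - C` with `C = (η ⊗ η)(B₁)`, up to the same factor. So `C - B₂` is invariant
(`map_linearPart_B_sub`).
-/

noncomputable section

namespace TwistDatum

variable {G V : Type*} [Group G] [AddCommGroup V] [Module ℂ V] (D : TwistDatum G V)

/-! ### The projection to the group algebra -/

/-- The skew primitive elements of `ℂ[G]` for `1` and a group-like `s` are the multiples of `1 - s`;
they commute with `s`. -/
theorem skewPrimitive_eq_zero_of_anticommute {G : Type*} [Group G] {x s : MonoidAlgebra ℂ G}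
    (hs : IsGroupLikeElem ℂ s) (hx : Coalgebra.comul (R := ℂ) x = x ⊗ₜ[ℂ] 1 + s ⊗ₜ[ℂ] x)
    (hsx : s * x = -(x * s)) : x = 0 := by
  classical
  obtain ⟨k, rfl⟩ := MonoidAlgebra.isGroupLikeElem_iff_mem_range_of.1 hs
  let δ : G → MonoidAlgebra ℂ G →ₗ[ℂ] ℂ := fun h =>
    Finsupp.lapply h ∘ₗ (MonoidAlgebra.coeffLinearEquiv ℂ).toLinearMap
  have hδ : ∀ h (y : MonoidAlgebra ℂ G), δ h y = y.coeff h := fun _ _ => rfl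
  -- The coefficient of `h ⊗ h` in `Δ(y)` is that of `h` in `y`.
  have hcoeff : ∀ h (y : MonoidAlgebra ℂ G),
      LinearMap.mul' ℂ ℂ (TensorProduct.map (δ h) (δ h) (Coalgebra.comul (R := ℂ) y)) =
        y.coeff h := by
    intro h y
    induction y using MonoidAlgebra.induction_linear with
    | zero => simp
    | add y z hy hz => simp [hy, hz]
    | single g c =>
      simp only [MonoidAlgebra.comul_single]
      by_cases hgh : g = h <;> simp [hδ, hgh]
  have hsupp : ∀ h, h ≠ 1 → h ≠ k → x.coeff h = 0 := by
    intro h h1 hk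
    rw [← hcoeff, hx]
    simp [hδ, MonoidAlgebra.one_def, h1.symm, hk.symm]
  -- `x` is a combination of `1` and `k`, so its coefficients at `k⁻¹ h` and `h k⁻¹` are both zero
  -- unless `h` is `k` or `k²`.
  have hcomm : MonoidAlgebra.of ℂ G k * x = x * MonoidAlgebra.of ℂ G k := by
    ext h
    simp only [MonoidAlgebra.of_apply, MonoidAlgebra.coeff_single_mul_apply,
      MonoidAlgebra.coeff_mul_single_apply, one_mul, mul_one]
    by_cases h1 : h = k
    · subst h1; simp
    by_cases h2 : h = k * k
    · subst h2; simp
    rw [hsupp, hsupp]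
    · rwa [Ne, mul_inv_eq_one]
    · rwa [Ne, mul_inv_eq_iff_eq_mul]
    · rwa [Ne, inv_mul_eq_one, eq_comm]
    · rwa [Ne, inv_mul_eq_iff_eq_mul]
  rw [hcomm, eq_neg_iff_add_eq_zero, ← two_smul ℂ, smul_eq_zero_iff_right two_ne_zero] at hsx
  simpa [MonoidAlgebra.single_mul_single, mul_assoc, ← MonoidAlgebra.one_def] using
    congrArg (· * MonoidAlgebra.of ℂ G k⁻¹) hsx

/-- The projection `ℂ[G] ⋉ ΛV → ℂ[G]` that kills `V`. -/
def toGrp : D.Alg →ₐ[ℂ] MonoidAlgebra ℂ G :=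
  D.lift (MonoidAlgebra.of ℂ G) 0 (fun v => by simp) (fun g v => by simp)

theorem toGrp_gr (g : G) : D.toGrp (D.gr g) = MonoidAlgebra.of ℂ G g := D.lift_gr _ _ _ _ g

theorem toGrp_vec (v : V) : D.toGrp (D.vec v) = 0 := D.lift_vec _ _ _ _ v

theorem counit_toGrp (x : D.Alg) :
    Coalgebra.counit (R := ℂ) (D.toGrp x) = Coalgebra.counit (R := ℂ) x := by
  have : (Bialgebra.counitAlgHom ℂ (MonoidAlgebra ℂ G)).comp D.toGrp =
      Bialgebra.counitAlgHom ℂ D.Alg :=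
    D.algHom_ext (fun g => by simp [toGrp_gr, counit_eq, hopfCounit_gr])
      (fun v => by simp [toGrp_vec, counit_eq, hopfCounit_vec])
  exact congrArg (fun f => f x) this

/-- A map that kills the second factor of `V ⊗ V` sends the factor `e^(B - g⁻¹B)` of `Δ(g)` to
`1`. -/
theorem map_comul_gr_of_right {C E : Type*} [Ring C] [Algebra ℂ C] [Ring E] [Algebra ℂ E]
    (a : D.Alg →ₐ[ℂ] C) (b : D.Alg →ₐ[ℂ] E) (hb : ∀ v, b (D.vec v) = 0) (g : G) :
    Algebra.TensorProduct.map a b (D.hopfComul (D.gr g)) = a (D.gr g) ⊗ₜ b (D.gr g) := by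
  have h : ∀ t, Algebra.TensorProduct.map a b (D.tens t) = 0 := by
    intro t
    induction t with
    | zero => simp
    | add x y hx hy => rw [map_add, map_add, hx, hy, add_zero]
    | tmul v w => simp [tens_tmul, hb]
  rw [hopfComul_gr, map_mul, map_nilExp _ (D.tens_isNilpotent _), h, nilExp_zero, mul_one,
    Algebra.TensorProduct.map_tmul]

theorem map_comul_gr_of_left {C E : Type*} [Ring C] [Algebra ℂ C] [Ring E] [Algebra ℂ E]
    (a : D.Alg →ₐ[ℂ] C) (b : D.Alg →ₐ[ℂ] E) (ha : ∀ v, a (D.vec v) = 0) (g : G) :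
    Algebra.TensorProduct.map a b (D.hopfComul (D.gr g)) = a (D.gr g) ⊗ₜ b (D.gr g) := by
  have h : ∀ t, Algebra.TensorProduct.map a b (D.tens t) = 0 := by
    intro t
    induction t with
    | zero => simp
    | add x y hx hy => rw [map_add, map_add, hx, hy, add_zero]
    | tmul v w => simp [tens_tmul, ha]
  rw [hopfComul_gr, map_mul, map_nilExp _ (D.tens_isNilpotent _), h, nilExp_zero, mul_one,
    Algebra.TensorProduct.map_tmul]

theorem comul_toGrp (x : D.Alg) : Coalgebra.comul (R := ℂ) (D.toGrp x) =
    Algebra.TensorProduct.map D.toGrp D.toGrp (D.hopfComul x) := by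
  have : (Bialgebra.comulAlgHom ℂ (MonoidAlgebra ℂ G)).comp D.toGrp =
      (Algebra.TensorProduct.map D.toGrp D.toGrp).comp D.hopfComul := by
    refine D.algHom_ext (fun g => ?_) (fun v => ?_)
    · simp only [AlgHom.comp_apply]
      rw [D.map_comul_gr_of_left _ _ D.toGrp_vec]
      simp [toGrp_gr]
    · simp [toGrp_vec, hopfComul_vec]
  exact congrArg (fun f => f x) this

/-! ### The component of degree one -/

/-- The representation of `ℂ[G] ⋉ ΛV` on `V ⊕ ℂ` in which `g` acts by `ρ(g) ⊕ 1` and `v ∈ V` sends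
`(w, c)` to `(c v, 0)`. -/
def jetRep : D.Alg →ₐ[ℂ] Module.End ℂ (V × ℂ) :=
  D.lift
    { toFun := fun g => (D.ρ g).prodMap LinearMap.id
      map_one' := by ext <;> simp
      map_mul' := fun g h => by ext <;> simp }
    { toFun := fun v => LinearMap.inl ℂ V ℂ ∘ₗ (LinearMap.toSpanSingleton ℂ V v) ∘ₗ
        LinearMap.snd ℂ V ℂ
      map_add' := fun v w => by ext <;> simp
      map_smul' := fun c v => by ext <;> simp }
    (fun v => by ext <;> simp)
    (fun g v => by ext <;> simp)

theorem jetRep_gr (g : G) (z : V × ℂ) : D.jetRep (D.gr g) z = (D.ρ g z.1, z.2) := by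
  rw [jetRep, lift_gr]; rfl

theorem jetRep_vec (v : V) (z : V × ℂ) : D.jetRep (D.vec v) z = (z.2 • v, 0) := by
  rw [jetRep, lift_vec]; rfl

/-- The linear map `ℂ[G] ⋉ ΛV → V` that sends `∑ α_g g` to the sum of the degree `1` components of
the `α_g ∈ ΛV`. It is the component in `V` of the orbit map of `1 ∈ ℂ` in the representation
`jetRep`. -/
def jet : D.Alg →ₗ[ℂ] V :=
  LinearMap.fst ℂ V ℂ ∘ₗ LinearMap.applyₗ ((0, 1) : V × ℂ) ∘ₗ D.jetRep.toLinearMap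

theorem jet_def (x : D.Alg) : D.jet x = (D.jetRep x (0, 1)).1 := rfl

theorem jet_gr (g : G) : D.jet (D.gr g) = 0 := by simp [jet_def, jetRep_gr]

theorem jet_vec (v : V) : D.jet (D.vec v) = v := by simp [jet_def, jetRep_vec]

theorem jetRep_apply (x : D.Alg) (z : V × ℂ) : D.jetRep x z =
    (D.ρ.asAlgebraHom (D.toGrp x) z.1 + z.2 • D.jet x, z.2 * Coalgebra.counit (R := ℂ) x) := by
  have h1 : ∀ x w, D.jetRep x (w, 0) = (D.ρ.asAlgebraHom (D.toGrp x) w, 0) := by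
    intro x
    induction x using D.alg_induction with
    | hc c => intro w; simp [Algebra.algebraMap_eq_smul_one]
    | hg g => intro w; simp [jetRep_gr, toGrp_gr]
    | hv v => intro w; simp [jetRep_vec, toGrp_vec]
    | hadd x y hx hy => intro w; simp [hx, hy]
    | hmul x y hx hy => intro w; simp [hx, hy]
  have h2 : ∀ x, (D.jetRep x (0, 1)).2 = Coalgebra.counit (R := ℂ) x := by
    intro x
    induction x using D.alg_induction with
    | hc c => simp [Algebra.algebraMap_eq_smul_one]
    | hg g => simp [jetRep_gr, counit_eq, hopfCounit_gr]
    | hv v => simp [jetRep_vec, counit_eq, hopfCounit_vec]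
    | hadd x y hx hy => simp [hx, hy]
    | hmul x y hx hy =>
      have h : D.jetRep y (0, 1) = ((D.jetRep y (0, 1)).1, 0) +
        (D.jetRep y (0, 1)).2 • ((0, 1) : V × ℂ) := by ext <;> simp
      rw [map_mul, Module.End.mul_apply, h, map_add, map_smul, h1]
      simp [hx, hy, mul_comm]
  have h : z = (z.1, 0) + z.2 • ((0, 1) : V × ℂ) := by ext <;> simp
  rw [h, map_add, map_smul, h1]
  ext
  · simp [jet_def]
  · simp [h2]

theorem jet_mul (x y : D.Alg) : D.jet (x * y) =
    D.ρ.asAlgebraHom (D.toGrp x) (D.jet y) + Coalgebra.counit (R := ℂ) y • D.jet x := by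
  rw [jet_def, map_mul, Module.End.mul_apply, D.jetRep_apply y, D.jetRep_apply x]
  simp

/-- The left and right `ℂ[G]`-coactions on the part of degree `1`: an element `v g` has degree `g` for
the right coaction and degree `u g` for the left one. -/
theorem toGrp_jet_comul (x : D.Alg) :
    TensorProduct.map D.toGrp.toLinearMap D.jet (D.hopfComul x) =
      TensorProduct.map (LinearMap.mulLeft ℂ (MonoidAlgebra.of ℂ G D.u)) LinearMap.id
        (TensorProduct.comm ℂ _ _
          (TensorProduct.map D.jet D.toGrp.toLinearMap (D.hopfComul x))) := by
  -- As algebra maps to `ℂ[G] ⊗ End (V ⊕ ℂ)`, the two coactions are conjugate by the element `c`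
  -- that is `u` on `V` and `1` on `ℂ`.
  let NL : D.Alg →ₐ[ℂ] MonoidAlgebra ℂ G ⊗[ℂ] Module.End ℂ (V × ℂ) :=
    (Algebra.TensorProduct.map D.toGrp D.jetRep).comp D.hopfComul
  let NR : D.Alg →ₐ[ℂ] MonoidAlgebra ℂ G ⊗[ℂ] Module.End ℂ (V × ℂ) :=
    (Algebra.TensorProduct.comm ℂ _ _).toAlgHom.comp
      ((Algebra.TensorProduct.map D.jetRep D.toGrp).comp D.hopfComul)
  let pV : Module.End ℂ (V × ℂ) := LinearMap.inl ℂ V ℂ ∘ₗ LinearMap.fst ℂ V ℂ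
  let pC : Module.End ℂ (V × ℂ) := LinearMap.inr ℂ V ℂ ∘ₗ LinearMap.snd ℂ V ℂ
  let c : MonoidAlgebra ℂ G ⊗[ℂ] Module.End ℂ (V × ℂ) :=
    MonoidAlgebra.of ℂ G D.u ⊗ₜ pV + 1 ⊗ₜ pC
  have key : c * NR x = NL x * c := by
    induction x using D.alg_induction with
    | hc r => rw [AlgHom.commutes, AlgHom.commutes]; exact (Algebra.commutes _ _).symm
    | hg g =>
      have hL : NL (D.gr g) = MonoidAlgebra.of ℂ G g ⊗ₜ D.jetRep (D.gr g) := by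
        simp only [NL, AlgHom.comp_apply]
        rw [D.map_comul_gr_of_left _ _ D.toGrp_vec, toGrp_gr]
      have hR : NR (D.gr g) = MonoidAlgebra.of ℂ G g ⊗ₜ D.jetRep (D.gr g) := by
        simp only [NR, AlgHom.comp_apply]
        rw [D.map_comul_gr_of_right _ _ D.toGrp_vec, toGrp_gr]
        rfl
      have h1 : pV * D.jetRep (D.gr g) = D.jetRep (D.gr g) * pV := by
        ext z <;> simp [pV, jetRep_gr]
      have h2 : pC * D.jetRep (D.gr g) = D.jetRep (D.gr g) * pC := by
        ext z <;> simp [pC, jetRep_gr]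
      rw [hL, hR]
      simp only [c, mul_add, add_mul, Algebra.TensorProduct.tmul_mul_tmul, one_mul, mul_one, h1, h2,
        ← map_mul, Subgroup.mem_center_iff.1 D.u_central g]
    | hv v =>
      have hL : NL (D.vec v) = MonoidAlgebra.of ℂ G D.u ⊗ₜ D.jetRep (D.vec v) := by
        simp [NL, hopfComul_vec, toGrp_vec, toGrp_gr]
      have hR : NR (D.vec v) = 1 ⊗ₜ D.jetRep (D.vec v) := by
        simp [NR, hopfComul_vec, toGrp_vec]
      have h1 : pV * D.jetRep (D.vec v) = D.jetRep (D.vec v) := by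
        ext z <;> simp [pV, jetRep_vec]
      have h2 : pC * D.jetRep (D.vec v) = 0 := by
        ext z <;> simp [pC, jetRep_vec]
      have h3 : D.jetRep (D.vec v) * pV = 0 := by
        ext z <;> simp [pV, jetRep_vec]
      have h4 : D.jetRep (D.vec v) * pC = D.jetRep (D.vec v) := by
        ext z <;> simp [pC, jetRep_vec]
      rw [hL, hR]
      simp only [c, mul_add, add_mul, Algebra.TensorProduct.tmul_mul_tmul, mul_one, h1, h2, h3, h4,
        TensorProduct.tmul_zero, add_zero, zero_add]
    | hadd x y hx hy => rw [map_add, map_add, mul_add c, add_mul (NL x), hx, hy]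
    | hmul x y hx hy => rw [map_mul, map_mul, ← mul_assoc, hx, mul_assoc, hy, mul_assoc]
  let ev : MonoidAlgebra ℂ G ⊗[ℂ] Module.End ℂ (V × ℂ) →ₗ[ℂ] MonoidAlgebra ℂ G ⊗[ℂ] V :=
    TensorProduct.map LinearMap.id (LinearMap.fst ℂ V ℂ ∘ₗ LinearMap.applyₗ ((0, 1) : V × ℂ))
  have hev : ∀ z, ev (z * c) = ev z := by
    intro z
    induction z with
    | zero => simp
    | add a b ha hb => rw [add_mul, map_add, ha, hb, map_add]
    | tmul a b => simp [c, ev, mul_add, pV, pC, Prod.mk_zero_zero]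
  have hev' : ∀ z, ev (c * z) = TensorProduct.map
      (LinearMap.mulLeft ℂ (MonoidAlgebra.of ℂ G D.u)) LinearMap.id (ev z) := by
    intro z
    induction z with
    | zero => simp
    | add a b ha hb => rw [mul_add, map_add, ha, hb, map_add, map_add]
    | tmul a b => simp [c, ev, add_mul, pV, pC]
  have h := congrArg ev key
  rw [hev, hev'] at h
  have hL : ∀ w, ev (Algebra.TensorProduct.map D.toGrp D.jetRep w) =
      TensorProduct.map D.toGrp.toLinearMap D.jet w := by
    intro w
    induction w with
    | zero => simp
    | add a b ha hb => simp only [map_add, ha, hb]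
    | tmul a b => rfl
  have hR : ∀ w, ev (Algebra.TensorProduct.comm ℂ _ _
      (Algebra.TensorProduct.map D.jetRep D.toGrp w)) =
      TensorProduct.comm ℂ _ _ (TensorProduct.map D.jet D.toGrp.toLinearMap w) := by
    intro w
    induction w with
    | zero => simp
    | add a b ha hb => simp only [map_add, ha, hb]
    | tmul a b => rfl
  rw [← hL, ← hR]
  exact h.symm

/-! ### The component of the comultiplication in `V ⊗ V` -/

theorem nilExp_apply_of_sq {M : Type*} [AddCommGroup M] [Module ℂ M] {T : Module.End ℂ M}
    (hT : IsNilpotent T) {x y : M} (hx : T x = y) (hy : T y = 0) : nilExp T x = x + y := by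
  obtain ⟨k, hk⟩ := hT
  have h : ∀ n, (T ^ (n + 1 + 1)) x = 0 := fun n => by
    rw [pow_succ, pow_succ, Module.End.mul_apply, Module.End.mul_apply, hx, hy, map_zero]
  rw [nilExp_eq_sum (pow_eq_zero_of_le (show k ≤ k + 1 + 1 by omega) hk), Finset.sum_range_succ',
    Finset.sum_range_succ']
  simp only [pow_zero, pow_one, zero_add]
  simp [h, hx, add_comm x]

/-- The algebra `ΛV` is generated by `V`. -/
theorem ext_induction {P : D.Alg → Prop} (hc : ∀ c : ℂ, P (algebraMap ℂ D.Alg c))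
    (hv : ∀ v, P (D.vec v)) (hadd : ∀ x y, P x → P y → P (x + y))
    (hmul : ∀ x y, P x → P y → P (x * y)) (a : D.Ext) : P (D.ext a) := by
  revert a
  show ∀ a : ExteriorAlgebra ℂ V, P (D.ext a)
  intro a
  induction a using ExteriorAlgebra.induction with
  | algebraMap r => exact (D.ext.commutes r).symm ▸ hc r
  | ι v => exact hv v
  | mul a b ha hb => exact (map_mul D.ext a b).symm ▸ hmul _ _ ha hb
  | add a b ha hb => exact (map_add D.ext a b).symm ▸ hadd _ _ ha hb

theorem linear_induction {P : D.Alg → Prop} (h0 : P 0)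
    (hs : ∀ a g, P (D.ext a * D.gr g)) (hadd : ∀ x y, P x → P y → P (x + y)) (x : D.Alg) :
    P x := by
  induction x using SkewMonoidAlgebra.induction_on with
  | zero => exact h0
  | single g a => rw [single_eq]; exact hs a g
  | add x y hx hy => exact hadd x y hx hy

/-- The action of the tensor square of `ℂ[G] ⋉ ΛV` on the tensor square of `V ⊕ ℂ`. -/
def jetPair : D.Alg ⊗[ℂ] D.Alg →ₐ[ℂ] Module.End ℂ ((V × ℂ) ⊗[ℂ] (V × ℂ)) :=
  (Module.endTensorEndAlgHom (R := ℂ) (S := ℂ) (A := ℂ)).comp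
    (Algebra.TensorProduct.map D.jetRep D.jetRep)

theorem jetPair_tmul (x y : D.Alg) (z w : V × ℂ) :
    D.jetPair (x ⊗ₜ y) (z ⊗ₜ w) = D.jetRep x z ⊗ₜ D.jetRep y w := rfl

variable (V) in
/-- The vector `1 ⊗ 1` of `(V ⊕ ℂ) ⊗ (V ⊕ ℂ)`. -/
def vac : (V × ℂ) ⊗[ℂ] (V × ℂ) := (0, 1) ⊗ₜ (0, 1)

variable (V) in
/-- The inclusion of `V ⊗ V` in `(V ⊕ ℂ) ⊗ (V ⊕ ℂ)`. -/
def inlPair : V ⊗[ℂ] V →ₗ[ℂ] (V × ℂ) ⊗[ℂ] (V × ℂ) :=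
  TensorProduct.map (LinearMap.inl ℂ V ℂ) (LinearMap.inl ℂ V ℂ)

variable (V) in
/-- The projection of `(V ⊕ ℂ) ⊗ (V ⊕ ℂ)` on `V ⊗ V`. -/
def fstPair : (V × ℂ) ⊗[ℂ] (V × ℂ) →ₗ[ℂ] V ⊗[ℂ] V :=
  TensorProduct.map (LinearMap.fst ℂ V ℂ) (LinearMap.fst ℂ V ℂ)

theorem fstPair_inlPair (t : V ⊗[ℂ] V) : fstPair V (inlPair V t) = t := by
  induction t with
  | zero => simp
  | add x y hx hy => rw [map_add, map_add, hx, hy]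
  | tmul v w => simp [fstPair, inlPair]

theorem fstPair_vac : fstPair V (vac V) = 0 := by simp [fstPair, vac]

theorem jetPair_inlPair (x y : D.Alg) (t : V ⊗[ℂ] V) :
    D.jetPair (x ⊗ₜ y) (inlPair V t) = inlPair V (TensorProduct.map
      (D.ρ.asAlgebraHom (D.toGrp x)) (D.ρ.asAlgebraHom (D.toGrp y)) t) := by
  induction t with
  | zero => simp
  | add a b ha hb => simp only [map_add, ha, hb]
  | tmul v w =>
    rw [inlPair, TensorProduct.map_tmul, jetPair_tmul, jetRep_apply, jetRep_apply,
      TensorProduct.map_tmul, TensorProduct.map_tmul]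
    simp

theorem jetPair_vac {x : D.Alg} (hx : D.jet x = 0) (h1 : Coalgebra.counit (R := ℂ) x = 1) :
    D.jetPair (x ⊗ₜ x) (vac V) = vac V := by
  rw [vac, jetPair_tmul, jetRep_apply, hx, h1]
  simp

theorem jetPair_comul_ext_inlPair (a : D.Ext) (t : V ⊗[ℂ] V) :
    D.jetPair (D.hopfComul (D.ext a)) (inlPair V t) =
      Coalgebra.counit (R := ℂ) (D.ext a) • inlPair V t := by
  revert t
  refine D.ext_induction (P := fun y => ∀ t, D.jetPair (D.hopfComul y) (inlPair V t) =
    Coalgebra.counit (R := ℂ) y • inlPair V t)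
    (fun c => ?_) (fun v => ?_) (fun x y hx hy => ?_) (fun x y hx hy => ?_) a
  · intro t; simp [Algebra.algebraMap_eq_smul_one]
  · intro t
    rw [hopfComul_vec, map_add, LinearMap.add_apply, jetPair_inlPair, jetPair_inlPair, counit_eq,
      hopfCounit_vec, toGrp_vec]
    simp
  · intro t; simp [hx, hy, add_smul]
  · intro t
    rw [map_mul, map_mul, Module.End.mul_apply, hy, map_smul, hx, Bialgebra.counit_mul, mul_smul,
      smul_comm]

/-- The Hopf superalgebra `ΛV` is super cocommutative, and elements of `V` are odd; hence the component
of `Δ(a)` in `V ⊗ V` is antisymmetric. -/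
theorem comm_fstPair_comul_ext (a : D.Ext) :
    TensorProduct.comm ℂ V V (fstPair V (D.jetPair (D.hopfComul (D.ext a)) (vac V))) =
      -fstPair V (D.jetPair (D.hopfComul (D.ext a)) (vac V)) := by
  -- `S` is the subspace of the super symmetric tensors; it contains `1 ⊗ 1` and is stable under `ΛV`.
  let S : (V × ℂ) ⊗[ℂ] (V × ℂ) → Prop := fun z => ∃ (c : ℂ) (v : V) (t : V ⊗[ℂ] V),
    TensorProduct.comm ℂ V V t = -t ∧
      z = c • vac V + (((v, 0) : V × ℂ) ⊗ₜ[ℂ] ((0, 1) : V × ℂ) +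
        ((0, 1) : V × ℂ) ⊗ₜ[ℂ] ((v, 0) : V × ℂ)) + inlPair V t
  have hS : ∀ z, S z → S (D.jetPair (D.hopfComul (D.ext a)) z) := by
    refine D.ext_induction (P := fun y => ∀ z, S z → S (D.jetPair (D.hopfComul y) z))
      (fun r => ?_) (fun w => ?_) (fun x y hx hy => ?_) (fun x y hx hy => ?_) a
    · rintro _ ⟨c, v, t, ht, rfl⟩
      refine ⟨r * c, r • v, r • t, by rw [map_smul, ht, smul_neg], ?_⟩
      have hs : ((r • v, 0) : V × ℂ) = r • (v, 0) := by simp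
      rw [hs, TensorProduct.tmul_smul, ← TensorProduct.smul_tmul', map_smul, mul_smul]
      simp [Algebra.algebraMap_eq_smul_one]
    · rintro _ ⟨c, v, t, ht, rfl⟩
      refine ⟨0, c • w, w ⊗ₜ v - v ⊗ₜ w, by simp, ?_⟩
      rw [hopfComul_vec, map_add]
      simp only [map_add, LinearMap.add_apply, jetPair_inlPair, map_smul, vac, jetPair_tmul,
        jetRep_vec, jetRep_gr, toGrp_vec]
      have hs : ((c • w, 0) : V × ℂ) = c • (w, 0) := by simp
      have hn : ((-v, 0) : V × ℂ) = -(v, 0) := by simp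
      simp only [hs, hn, inlPair, D.ρ_u, one_smul, zero_smul, map_zero, map_sub,
        TensorProduct.map_tmul, LinearMap.inl_apply, Prod.mk_zero_zero, TensorProduct.zero_tmul,
        TensorProduct.tmul_zero, TensorProduct.neg_tmul, TensorProduct.tmul_smul,
        TensorProduct.map_zero_left, TensorProduct.map_zero_right, map_one, Module.End.one_apply,
        LinearMap.zero_apply, add_zero, zero_add,
        ← TensorProduct.smul_tmul', smul_add]
      abel_nf
    · intro z hz
      obtain ⟨c, v, t, ht, h⟩ := hx z hz
      obtain ⟨c', v', t', ht', h'⟩ := hy z hz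
      refine ⟨c + c', v + v', t + t', by rw [map_add, ht, ht', neg_add], ?_⟩
      have hs : ((v + v', 0) : V × ℂ) = (v, 0) + (v', 0) := by simp
      rw [map_add, map_add, LinearMap.add_apply, h, h', hs, TensorProduct.add_tmul,
        TensorProduct.tmul_add, add_smul, map_add]
      abel
    · intro z hz
      rw [map_mul, map_mul, Module.End.mul_apply]
      exact hx _ (hy _ hz)
  obtain ⟨c, v, t, ht, h⟩ := hS (vac V) ⟨1, 0, 0, by simp, by simp [Prod.mk_zero_zero]⟩
  have h2 : fstPair V (D.jetPair (D.hopfComul (D.ext a)) (vac V)) = t := by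
    rw [h, map_add, map_add, map_smul, fstPair_vac, fstPair_inlPair]
    simp [fstPair]
  rw [h2, ht]

/-- The symmetrisation `t + tᵀ` of the component `t` of `Δ(x) (1 ⊗ 1)` in `V ⊗ V`. -/
def symJet : D.Alg →ₗ[ℂ] V ⊗[ℂ] V :=
  (LinearMap.id + (TensorProduct.comm ℂ V V).toLinearMap) ∘ₗ fstPair V ∘ₗ
    LinearMap.applyₗ (vac V) ∘ₗ D.jetPair.toLinearMap ∘ₗ D.hopfComul.toLinearMap

theorem symJet_apply (x : D.Alg) : D.symJet x = fstPair V (D.jetPair (D.hopfComul x) (vac V)) +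
    TensorProduct.comm ℂ V V (fstPair V (D.jetPair (D.hopfComul x) (vac V))) := rfl

section MapComul

variable {G₁ G₂ V₁ V₂ : Type*} [Group G₁] [Group G₂] [AddCommGroup V₁] [Module ℂ V₁]
  [AddCommGroup V₂] [Module ℂ V₂] {D₁ : TwistDatum G₁ V₁} {D₂ : TwistDatum G₂ V₂}
  (f : D₁.Alg →ₐc[ℂ] D₂.Alg)

theorem hopfComul_map (x : D₁.Alg) : D₂.hopfComul (f x) =
    Algebra.TensorProduct.map (f : D₁.Alg →ₐ[ℂ] D₂.Alg) (f : D₁.Alg →ₐ[ℂ] D₂.Alg)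
      (D₁.hopfComul x) :=
  (CoalgHomClass.map_comp_comul_apply f x).symm

theorem toGrp_map_vec (v : V₁) : D₂.toGrp (f (D₁.vec v)) = 0 := by
  have hu : IsGroupLikeElem ℂ (D₁.gr D₁.u) :=
    ⟨D₁.hopfCounit_gr D₁.u, D₁.hopfComul_gr_u⟩
  refine skewPrimitive_eq_zero_of_anticommute (s := D₂.toGrp (f (D₁.gr D₁.u))) ⟨?_, ?_⟩ ?_ ?_
  · rw [counit_toGrp]
    exact (hu.map f).counit_eq_one
  · rw [comul_toGrp, ← comul_eq, (hu.map f).comul_eq_tmul_self, Algebra.TensorProduct.map_tmul]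
  · rw [comul_toGrp, hopfComul_map, hopfComul_vec]
    simp
  · rw [← map_mul, ← map_mul, gr_u_mul_vec, map_neg, map_neg, map_mul, map_mul]

theorem isGroupLikeElem_toGrp_map_gr (g : G₁) :
    IsGroupLikeElem ℂ (D₂.toGrp (f (D₁.gr g))) where
  counit_eq_one := by
    rw [counit_toGrp, CoalgHomClass.counit_comp_apply]
    exact D₁.hopfCounit_gr g
  comul_eq_tmul_self := by
    have h := D₁.map_comul_gr_of_left (D₂.toGrp.comp (f : D₁.Alg →ₐ[ℂ] D₂.Alg))
      (D₂.toGrp.comp (f : D₁.Alg →ₐ[ℂ] D₂.Alg)) (fun v => toGrp_map_vec f v) g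
    rw [comul_toGrp, hopfComul_map]
    rw [Algebra.TensorProduct.map_comp] at h
    exact h

/-- The linear map `V₁ → V₂` induced by a map of Hopf algebras `f`: the component of degree `1` of
`f(v)`. -/
def linearPart : V₁ →ₗ[ℂ] V₂ := D₂.jet ∘ₗ (f : D₁.Alg →ₐ[ℂ] D₂.Alg).toLinearMap ∘ₗ D₁.vec

theorem linearPart_apply (v : V₁) : linearPart f v = D₂.jet (f (D₁.vec v)) := rfl

theorem jetRep_map_vec (v : V₁) (z : V₂ × ℂ) :
    D₂.jetRep (f (D₁.vec v)) z = (z.2 • linearPart f v, 0) := by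
  rw [jetRep_apply, toGrp_map_vec, linearPart_apply, CoalgHomClass.counit_comp_apply, counit_eq,
    hopfCounit_vec]
  simp

theorem jetPair_map_tens (t : V₁ ⊗[ℂ] V₁) :
    D₂.jetPair (Algebra.TensorProduct.map (f : D₁.Alg →ₐ[ℂ] D₂.Alg)
      (f : D₁.Alg →ₐ[ℂ] D₂.Alg) (D₁.tens t)) (vac V₂) =
      inlPair V₂ (TensorProduct.map (linearPart f) (linearPart f) t) := by
  induction t with
  | zero => simp
  | add a b ha hb => simp only [map_add, LinearMap.add_apply, ha, hb]
  | tmul v w =>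
    rw [tens_tmul, Algebra.TensorProduct.map_tmul, vac, jetPair_tmul, map_mul]
    simp only [BialgHom.coe_toAlgHom, map_mul, Module.End.mul_apply, jetRep_map_vec,
      D₂.jetRep_apply (f (D₁.gr D₁.u)), CoalgHomClass.counit_comp_apply, counit_eq, hopfCounit_gr]
    simp [inlPair]

theorem jetPair_map_tens_inlPair (t : V₁ ⊗[ℂ] V₁) (s : V₂ ⊗[ℂ] V₂) :
    D₂.jetPair (Algebra.TensorProduct.map (f : D₁.Alg →ₐ[ℂ] D₂.Alg)
      (f : D₁.Alg →ₐ[ℂ] D₂.Alg) (D₁.tens t)) (inlPair V₂ s) = 0 := by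
  induction t with
  | zero => simp
  | add a b ha hb => simp only [map_add, LinearMap.add_apply, ha, hb, add_zero]
  | tmul v w =>
    rw [tens_tmul, Algebra.TensorProduct.map_tmul, jetPair_inlPair]
    simp only [BialgHom.coe_toAlgHom, map_mul, toGrp_map_vec]
    simp

theorem jetPair_comul_map_gr (g : G₁) :
    D₂.jetPair (D₂.hopfComul (f (D₁.gr g))) (vac V₂) =
      D₂.jetPair (f (D₁.gr g) ⊗ₜ f (D₁.gr g)) (vac V₂ +
        inlPair V₂ (TensorProduct.map (linearPart f) (linearPart f) (D₁.defect g))) := by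
  have hn := (D₁.tens_isNilpotent (D₁.defect g)).map (Algebra.TensorProduct.map
    (f : D₁.Alg →ₐ[ℂ] D₂.Alg) (f : D₁.Alg →ₐ[ℂ] D₂.Alg))
  rw [hopfComul_map, hopfComul_gr, map_mul, map_mul, Module.End.mul_apply,
    map_nilExp _ (D₁.tens_isNilpotent _),
    map_nilExp (S := Module.End ℂ ((V₂ × ℂ) ⊗[ℂ] (V₂ × ℂ))) D₂.jetPair hn,
    nilExp_apply_of_sq (hn.map D₂.jetPair) (jetPair_map_tens f _)
      (jetPair_map_tens_inlPair f _ _)]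
  rfl

end MapComul

theorem linearPart_id : linearPart (BialgHom.id ℂ D.Alg) = LinearMap.id :=
  LinearMap.ext D.jet_vec

theorem jetPair_comul_gr (g : G) : D.jetPair (D.hopfComul (D.gr g)) (vac V) =
    vac V + inlPair V (TensorProduct.map (D.ρ g) (D.ρ g) (D.defect g)) := by
  have h := jetPair_comul_map_gr (BialgHom.id ℂ D.Alg) g
  rw [linearPart_id, TensorProduct.map_id] at h
  refine h.trans ?_
  rw [map_add]
  refine congrArg₂ (· + ·) (D.jetPair_vac (D.jet_gr g) (D.hopfCounit_gr g)) ?_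
  refine (D.jetPair_inlPair _ _ _).trans ?_
  simp [toGrp_gr]

theorem symJet_ext_mul_gr (a : D.Ext) (g : G) :
    D.symJet (D.ext a * D.gr g) = Coalgebra.counit (R := ℂ) (D.ext a) • D.symJet (D.gr g) := by
  have h : fstPair V (D.jetPair (D.hopfComul (D.ext a * D.gr g)) (vac V)) =
      fstPair V (D.jetPair (D.hopfComul (D.ext a)) (vac V)) +
        Coalgebra.counit (R := ℂ) (D.ext a) •
          fstPair V (D.jetPair (D.hopfComul (D.gr g)) (vac V)) := by
    rw [map_mul, map_mul, Module.End.mul_apply, jetPair_comul_gr, map_add,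
      jetPair_comul_ext_inlPair]
    simp [fstPair_vac]
  rw [symJet_apply, symJet_apply, h, map_add, comm_fstPair_comul_ext, map_smul]
  module

theorem symJet_eq_of_toGrp {x : D.Alg} {g : G} (hx : D.toGrp x = MonoidAlgebra.of ℂ G g) :
    D.symJet x = D.symJet (D.gr g) := by
  -- `σ` is the section of the projection to `ℂ[G]`.
  let σ : MonoidAlgebra ℂ G →ₐ[ℂ] D.Alg := MonoidAlgebra.lift ℂ D.Alg G D.gr
  have h : ∀ x, D.symJet x = D.symJet (σ (D.toGrp x)) := by
    intro x
    refine D.linear_induction (P := fun x => D.symJet x = D.symJet (σ (D.toGrp x)))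
      (by simp only [map_zero]) (fun a g => ?_) (fun x y hx hy => by simp only [map_add, hx, hy]) x
    have ha : D.toGrp (D.ext a) =
        algebraMap ℂ (MonoidAlgebra ℂ G) (Coalgebra.counit (R := ℂ) (D.ext a)) := by
      refine D.ext_induction (P := fun y => D.toGrp y =
        algebraMap ℂ (MonoidAlgebra ℂ G) (Coalgebra.counit (R := ℂ) y))
        (fun c => ?_) (fun v => ?_) (fun x y hx hy => ?_) (fun x y hx hy => ?_) a
      · rw [AlgHom.commutes, Bialgebra.counit_algebraMap]
      · rw [toGrp_vec, counit_eq, hopfCounit_vec, map_zero]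
      · rw [map_add, map_add, map_add, hx, hy]
      · rw [map_mul, Bialgebra.counit_mul, map_mul, hx, hy]
    rw [symJet_ext_mul_gr, map_mul, ha, map_mul, AlgHom.commutes, toGrp_gr,
      ← Algebra.smul_def, map_smul, MonoidAlgebra.lift_of]
  rw [h, hx, MonoidAlgebra.lift_of]

/-! ### The group homomorphism and the linear map induced by a map of Hopf algebras -/

theorem of_tmul_cancel {y : V} (hy : y ≠ 0) {g h : G}
    (e : MonoidAlgebra.of ℂ G g ⊗ₜ[ℂ] y = MonoidAlgebra.of ℂ G h ⊗ₜ[ℂ] y) : g = h := by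
  classical
  by_contra hgh
  have h2 := congrArg ((TensorProduct.lid ℂ V).toLinearMap ∘ₗ TensorProduct.map
    (Finsupp.lapply g ∘ₗ (MonoidAlgebra.coeffLinearEquiv ℂ).toLinearMap) LinearMap.id) e
  simp [Ne.symm hgh] at h2
  exact hy h2

theorem u_ne_one [Nontrivial V] : D.u ≠ 1 := by
  intro h
  obtain ⟨v, hv⟩ := exists_ne (0 : V)
  have h2 := D.ρ_u v
  rw [h, map_one, Module.End.one_apply, eq_neg_iff_add_eq_zero, ← two_smul ℂ,
    smul_eq_zero_iff_right two_ne_zero] at h2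
  exact hv h2

theorem map_defect (g : G) :
    TensorProduct.map (D.ρ g) (D.ρ g) (D.defect g) =
      TensorProduct.map (D.ρ g) (D.ρ g) D.B - D.B := by
  rw [defect, map_sub, ← LinearMap.comp_apply (f := TensorProduct.map _ _),
    ← TensorProduct.map_comp, ← Module.End.mul_eq_comp, ← map_mul, mul_inv_cancel, map_one,
    Module.End.one_eq_id, TensorProduct.map_id,
    LinearMap.id_apply]

theorem map_mem_symTensors {W : Type*} [AddCommGroup W] [Module ℂ W] (h : V →ₗ[ℂ] W) {t : V ⊗[ℂ] V}
    (ht : t ∈ symTensors V) : TensorProduct.map h h t ∈ symTensors W := by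
  show TensorProduct.comm ℂ W W _ = _
  rw [← TensorProduct.map_comm]
  exact congrArg _ ht

section Hom

variable {G₁ G₂ G₃ V₁ V₂ V₃ : Type*} [Group G₁] [Group G₂] [Group G₃] [AddCommGroup V₁]
  [Module ℂ V₁] [AddCommGroup V₂] [Module ℂ V₂] [AddCommGroup V₃] [Module ℂ V₃]
  {D₁ : TwistDatum G₁ V₁} {D₂ : TwistDatum G₂ V₂} {D₃ : TwistDatum G₃ V₃}
  (f : D₁.Alg →ₐc[ℂ] D₂.Alg) (e : D₂.Alg →ₐc[ℂ] D₃.Alg)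

theorem exists_toGrp_map_gr (g : G₁) :
    ∃ h : G₂, D₂.toGrp (f (D₁.gr g)) = MonoidAlgebra.of ℂ G₂ h := by
  obtain ⟨h, hh⟩ := MonoidAlgebra.isGroupLikeElem_iff_mem_range_of.1
    (isGroupLikeElem_toGrp_map_gr f g)
  exact ⟨h, hh.symm⟩

/-- The group homomorphism `φ : G₁ → G₂` induced by a map of Hopf algebras `f`: `φ(g)` is congruent
to `f(g)` modulo the ideal generated by `V₂`. -/
def grpPart : G₁ →* G₂ where
  toFun g := (exists_toGrp_map_gr f g).choose
  map_one' := by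
    apply MonoidAlgebra.of_injective (R := ℂ)
    refine (exists_toGrp_map_gr f 1).choose_spec.symm.trans ?_
    rw [map_one, map_one, map_one, map_one]
  map_mul' g h := by
    apply MonoidAlgebra.of_injective (R := ℂ)
    refine (exists_toGrp_map_gr f (g * h)).choose_spec.symm.trans ?_
    rw [map_mul, map_mul, map_mul, map_mul]
    exact congrArg₂ (· * ·) (exists_toGrp_map_gr f g).choose_spec
      (exists_toGrp_map_gr f h).choose_spec

theorem toGrp_map_gr (g : G₁) :
    D₂.toGrp (f (D₁.gr g)) = MonoidAlgebra.of ℂ G₂ (grpPart f g) :=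
  (exists_toGrp_map_gr f g).choose_spec

theorem toGrp_map (x : D₁.Alg) : D₂.toGrp (f x) =
    MonoidAlgebra.lift ℂ _ G₁ ((MonoidAlgebra.of ℂ G₂).comp (grpPart f)) (D₁.toGrp x) := by
  have : D₂.toGrp.comp (f : D₁.Alg →ₐ[ℂ] D₂.Alg) =
      (MonoidAlgebra.lift ℂ _ G₁ ((MonoidAlgebra.of ℂ G₂).comp (grpPart f))).comp D₁.toGrp := by
    refine D₁.algHom_ext (fun g => ?_) (fun v => ?_)
    · rw [AlgHom.comp_apply, AlgHom.comp_apply, toGrp_gr, MonoidAlgebra.lift_of]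
      exact toGrp_map_gr f g
    · rw [AlgHom.comp_apply, AlgHom.comp_apply, toGrp_vec, map_zero]
      exact toGrp_map_vec f v
  exact congrArg (fun f => f x) this

theorem linearPart_equivariant (g : G₁) (v : V₁) :
    linearPart f (D₁.ρ g v) = D₂.ρ (grpPart f g) (linearPart f v) := by
  have h := congrArg (fun x => D₂.jet (f x)) (D₁.gr_mul_vec g v)
  simp only [map_mul, jet_mul, toGrp_map_gr, toGrp_map_vec, Representation.asAlgebraHom_of,
    CoalgHomClass.counit_comp_apply, counit_eq, hopfCounit_vec, hopfCounit_gr, map_zero,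
    LinearMap.zero_apply, zero_smul, add_zero, one_smul, zero_add] at h
  exact h.symm

/-- The coactions of `ℂ[G₂]` on the degree `1` part of `f(g)` are both of degree `φ(g)`, whereas they
differ by the factor `u₂ ≠ 1`. -/
theorem jet_map_gr [Nontrivial V₂] (g : G₁) : D₂.jet (f (D₁.gr g)) = 0 := by
  by_contra hne
  have hL : ∀ z : D₁.Alg ⊗[ℂ] D₁.Alg, TensorProduct.map D₂.toGrp.toLinearMap D₂.jet
      (Algebra.TensorProduct.map (f : D₁.Alg →ₐ[ℂ] D₂.Alg) (f : D₁.Alg →ₐ[ℂ] D₂.Alg) z) =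
      TensorProduct.map LinearMap.id D₂.jet (Algebra.TensorProduct.map
        (D₂.toGrp.comp (f : D₁.Alg →ₐ[ℂ] D₂.Alg)) (f : D₁.Alg →ₐ[ℂ] D₂.Alg) z) := by
    intro z
    induction z with
    | zero => simp
    | add a b ha hb => simp only [map_add, ha, hb]
    | tmul a b => rfl
  have hR : ∀ z : D₁.Alg ⊗[ℂ] D₁.Alg, TensorProduct.map D₂.jet D₂.toGrp.toLinearMap
      (Algebra.TensorProduct.map (f : D₁.Alg →ₐ[ℂ] D₂.Alg) (f : D₁.Alg →ₐ[ℂ] D₂.Alg) z) =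
      TensorProduct.map D₂.jet LinearMap.id (Algebra.TensorProduct.map
        (f : D₁.Alg →ₐ[ℂ] D₂.Alg) (D₂.toGrp.comp (f : D₁.Alg →ₐ[ℂ] D₂.Alg)) z) := by
    intro z
    induction z with
    | zero => simp
    | add a b ha hb => simp only [map_add, ha, hb]
    | tmul a b => rfl
  have h := D₂.toGrp_jet_comul (f (D₁.gr g))
  rw [hopfComul_map, hL, hR, D₁.map_comul_gr_of_left _ _ (toGrp_map_vec f),
    D₁.map_comul_gr_of_right _ _ (toGrp_map_vec f), TensorProduct.map_tmul,
    TensorProduct.map_tmul, TensorProduct.comm_tmul, TensorProduct.map_tmul] at h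
  simp only [AlgHom.comp_apply, BialgHom.coe_toAlgHom, toGrp_map_gr, LinearMap.id_apply,
    LinearMap.mulLeft_apply, ← map_mul] at h
  exact D₂.u_ne_one (right_eq_mul.1 (of_tmul_cancel hne h))

/-- The degree `1` part of `f(v)` has degree `φ(u₁)` for the left coaction of `ℂ[G₂]` and degree `1` for
the right one. -/
theorem grpPart_u {v : V₁} (hv : linearPart f v ≠ 0) : grpPart f D₁.u = D₂.u := by
  have h := D₂.toGrp_jet_comul (f (D₁.vec v))
  rw [hopfComul_map, hopfComul_vec] at h
  simp only [map_add, Algebra.TensorProduct.map_tmul, TensorProduct.map_tmul,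
    BialgHom.coe_toAlgHom, AlgHom.toLinearMap_apply, toGrp_map_vec, toGrp_map_gr, map_one,
    TensorProduct.zero_tmul, TensorProduct.tmul_zero, zero_add, add_zero,
    TensorProduct.comm_tmul, LinearMap.mulLeft_apply, LinearMap.id_apply, mul_one,
    ← linearPart_apply] at h
  exact of_tmul_cancel hv h

theorem jet_map [Nontrivial V₂] (x : D₁.Alg) : D₂.jet (f x) = linearPart f (D₁.jet x) := by
  have hρ : ∀ (x : D₁.Alg) (w : V₁), D₂.ρ.asAlgebraHom (D₂.toGrp (f x)) (linearPart f w) =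
      linearPart f (D₁.ρ.asAlgebraHom (D₁.toGrp x) w) := by
    intro x
    induction x using D₁.alg_induction with
    | hc c => intro w; simp [Algebra.algebraMap_eq_smul_one]
    | hg g =>
      intro w
      rw [toGrp_map_gr, toGrp_gr, Representation.asAlgebraHom_of, Representation.asAlgebraHom_of,
        linearPart_equivariant]
    | hv v => intro w; rw [toGrp_map_vec, toGrp_vec]; simp
    | hadd x y hx hy => intro w; simp [hx, hy]
    | hmul x y hx hy => intro w; simp [hx, hy]
  induction x using D₁.alg_induction with
  | hc c => simp [Algebra.algebraMap_eq_smul_one, jet_def]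
  | hg g => rw [jet_map_gr, jet_gr, map_zero]
  | hv v => rw [jet_vec, linearPart_apply]
  | hadd x y hx hy => simp only [map_add, hx, hy]
  | hmul x y hx hy =>
    rw [map_mul, jet_mul, jet_mul, hx, hy, hρ, CoalgHomClass.counit_comp_apply, map_add, map_smul]

theorem linearPart_comp [Nontrivial V₃] (v : V₁) :
    linearPart (e.comp f) v = linearPart e (linearPart f v) :=
  jet_map e (f (D₁.vec v))

theorem grpPart_comp (g : G₁) : grpPart (e.comp f) g = grpPart e (grpPart f g) := by
  apply MonoidAlgebra.of_injective (R := ℂ)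
  rw [← toGrp_map_gr, BialgHom.comp_apply, toGrp_map, toGrp_map_gr, MonoidAlgebra.lift_of]
  rfl

theorem grpPart_id (g : G₁) : grpPart (BialgHom.id ℂ D₁.Alg) g = g := by
  apply MonoidAlgebra.of_injective (R := ℂ)
  rw [← toGrp_map_gr, BialgHom.id_apply, toGrp_gr]

theorem map_linearPart_map_rho (g : G₁) (t : V₁ ⊗[ℂ] V₁) :
    TensorProduct.map (linearPart f) (linearPart f) (TensorProduct.map (D₁.ρ g) (D₁.ρ g) t) =
      TensorProduct.map (D₂.ρ (grpPart f g)) (D₂.ρ (grpPart f g))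
        (TensorProduct.map (linearPart f) (linearPart f) t) := by
  induction t with
  | zero => simp
  | add a b ha hb => simp only [map_add, ha, hb]
  | tmul v w => simp only [TensorProduct.map_tmul, linearPart_equivariant]

/-- The comparison of the symmetric parts in `V₂ ⊗ V₂` of the two sides of
`Δ(f(g)) = (f ⊗ f)(Δ(g))`. -/
theorem map_linearPart_B_sub [Nontrivial V₂] (g : G₁) :
    TensorProduct.map (D₂.ρ (grpPart f g)) (D₂.ρ (grpPart f g))
      (TensorProduct.map (linearPart f) (linearPart f) D₁.B - D₂.B) =
    TensorProduct.map (linearPart f) (linearPart f) D₁.B - D₂.B := by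
  have h := D₂.symJet_eq_of_toGrp (toGrp_map_gr f g)
  have h1 : Coalgebra.counit (R := ℂ) (f (D₁.gr g)) = 1 := by
    rw [CoalgHomClass.counit_comp_apply]; exact D₁.hopfCounit_gr g
  rw [symJet_apply, symJet_apply, jetPair_comul_map_gr, jetPair_comul_gr] at h
  simp only [map_add, jetPair_vac _ (jet_map_gr f g) h1, fstPair_vac, jetPair_inlPair,
    fstPair_inlPair, zero_add, toGrp_map_gr, Representation.asAlgebraHom_of] at h
  rw [map_mem_symTensors _ (map_mem_symTensors _ (D₁.defect_mem g)),
    map_mem_symTensors _ (D₂.defect_mem _), ← two_smul ℂ,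
    ← two_smul ℂ, smul_right_inj two_ne_zero] at h
  rw [← map_linearPart_map_rho, map_defect, map_defect, map_sub, map_linearPart_map_rho] at h
  rw [map_sub, sub_eq_sub_iff_sub_eq_sub]
  exact h

end Hom

/-! ### The map of Hopf algebras induced by a group homomorphism and a linear map -/

section Lift

variable {G₁ G₂ V₁ V₂ : Type*} [Group G₁] [Group G₂] [AddCommGroup V₁]
  [Module ℂ V₁] [AddCommGroup V₂] [Module ℂ V₂]
  {D₁ : TwistDatum G₁ V₁} {D₂ : TwistDatum G₂ V₂}

/-- The algebra map induced by a group homomorphism `φ` and a `φ`-equivariant linear map `η`. -/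
def mapAlg (φ : G₁ →* G₂) (η : V₁ →ₗ[ℂ] V₂) (h : ∀ g v, η (D₁.ρ g v) = D₂.ρ (φ g) (η v)) :
    D₁.Alg →ₐ[ℂ] D₂.Alg :=
  D₁.lift (D₂.gr.comp φ) (D₂.vec ∘ₗ η) (fun v => D₂.vec_sq _)
    (fun g v => by simp [gr_mul_vec, h])

variable (φ : G₁ →* G₂) (η : V₁ →ₗ[ℂ] V₂) (h : ∀ g v, η (D₁.ρ g v) = D₂.ρ (φ g) (η v))

theorem mapAlg_gr (g : G₁) : mapAlg φ η h (D₁.gr g) = D₂.gr (φ g) := D₁.lift_gr _ _ _ _ g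

theorem mapAlg_vec (v : V₁) : mapAlg φ η h (D₁.vec v) = D₂.vec (η v) := D₁.lift_vec _ _ _ _ v

theorem map_mapAlg_tens (hu : φ D₁.u = D₂.u) (t : V₁ ⊗[ℂ] V₁) :
    Algebra.TensorProduct.map (mapAlg φ η h) (mapAlg φ η h) (D₁.tens t) =
      D₂.tens (TensorProduct.map η η t) := by
  induction t with
  | zero => simp
  | add a b ha hb => simp only [map_add, ha, hb]
  | tmul v w => simp [tens_tmul, mapAlg_gr, mapAlg_vec, hu]

theorem map_mapAlg_comul (hu : φ D₁.u = D₂.u)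
    (hB : ∀ g, TensorProduct.map η η (D₁.defect g) = D₂.defect (φ g)) :
    (Algebra.TensorProduct.map (mapAlg φ η h) (mapAlg φ η h)).comp D₁.hopfComul =
      D₂.hopfComul.comp (mapAlg φ η h) := by
  refine D₁.algHom_ext (fun g => ?_) (fun v => ?_)
  · rw [AlgHom.comp_apply, AlgHom.comp_apply, mapAlg_gr, hopfComul_gr, hopfComul_gr, map_mul,
      map_nilExp _ (D₁.tens_isNilpotent _), map_mapAlg_tens _ _ _ hu, hB,
      Algebra.TensorProduct.map_tmul, mapAlg_gr]
  · simp [hopfComul_vec, mapAlg_vec, mapAlg_gr, hu]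

theorem hopfCounit_mapAlg : D₂.hopfCounit.comp (mapAlg φ η h) = D₁.hopfCounit :=
  D₁.algHom_ext (fun g => by simp [mapAlg_gr, hopfCounit_gr])
    (fun v => by simp [mapAlg_vec, hopfCounit_vec])

end Lift

end TwistDatum

end

theorem proposition2p1 {G₁ G₂ V₁ V₂ : Type*}
    [Group G₁] [Finite G₁] [Group G₂] [Finite G₂]
    [AddCommGroup V₁] [Module ℂ V₁] [FiniteDimensional ℂ V₁] [Nontrivial V₁]
    [AddCommGroup V₂] [Module ℂ V₂] [FiniteDimensional ℂ V₂] [Nontrivial V₂]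
    (D₁ : TwistDatum G₁ V₁) (D₂ : TwistDatum G₂ V₂) :
    Nonempty (D₁.Alg ≃ₐc[ℂ] D₂.Alg) ↔
      ∃ φ : G₁ ≃* G₂, φ D₁.u = D₂.u ∧
        ∃ η : D₁.ρ.Equiv (D₂.ρ.comp φ.toMonoidHom),
          TensorProduct.map η.toLinearMap η.toLinearMap D₁.B - D₂.B ∈ symInvariants D₂.ρ := by
  constructor
  · rintro ⟨F⟩
    let f : D₁.Alg →ₐc[ℂ] D₂.Alg := F
    let e : D₂.Alg →ₐc[ℂ] D₁.Alg := F.symm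
    have hef : e.comp f = BialgHom.id ℂ D₁.Alg := BialgHom.ext F.symm_apply_apply
    have hfe : f.comp e = BialgHom.id ℂ D₂.Alg := BialgHom.ext F.apply_symm_apply
    let φ : G₁ ≃* G₂ := MonoidHom.toMulEquiv (TwistDatum.grpPart f) (TwistDatum.grpPart e)
      (MonoidHom.ext fun g => by
        rw [MonoidHom.comp_apply, ← TwistDatum.grpPart_comp, hef, TwistDatum.grpPart_id]; rfl)
      (MonoidHom.ext fun g => by
        rw [MonoidHom.comp_apply, ← TwistDatum.grpPart_comp, hfe, TwistDatum.grpPart_id]; rfl)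
    let η : V₁ ≃ₗ[ℂ] V₂ := LinearEquiv.ofLinearMap
      (TwistDatum.linearPart f) (TwistDatum.linearPart e)
      (LinearMap.ext fun v => by
        rw [LinearMap.comp_apply, ← TwistDatum.linearPart_comp, hfe, TwistDatum.linearPart_id])
      (LinearMap.ext fun v => by
        rw [LinearMap.comp_apply, ← TwistDatum.linearPart_comp, hef, TwistDatum.linearPart_id])
    obtain ⟨v, hv⟩ := exists_ne (0 : V₁)
    refine ⟨φ, TwistDatum.grpPart_u f (v := v) fun h => hv (η.map_eq_zero_iff.1 h),
      Representation.Equiv.mk η fun g => LinearMap.ext fun v =>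
        TwistDatum.linearPart_equivariant f g v, ?_⟩
    show TensorProduct.map (TwistDatum.linearPart f) (TwistDatum.linearPart f) D₁.B - D₂.B ∈ _
    refine ⟨sub_mem (TwistDatum.map_mem_symTensors _ D₁.B_mem) D₂.B_mem, fun g => ?_⟩
    obtain ⟨g, rfl⟩ := φ.surjective g
    exact TwistDatum.map_linearPart_B_sub f g
  · rintro ⟨φ, hu, η, hη, hB⟩
    have heq : ∀ g v, η.toLinearMap (D₁.ρ g v) = D₂.ρ (φ g) (η.toLinearMap v) := fun g v =>
      congrArg (fun F => F v) (η.isIntertwining' g)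
    have heq' : ∀ g v, η.toLinearEquiv.symm.toLinearMap (D₂.ρ g v) =
        D₁.ρ (φ.symm g) (η.toLinearEquiv.symm.toLinearMap v) := fun g v => by
      apply η.toLinearEquiv.injective
      refine (η.toLinearEquiv.apply_symm_apply _).trans ?_
      refine Eq.trans ?_ (heq (φ.symm g) _).symm
      rw [φ.apply_symm_apply]
      exact congrArg _ (η.toLinearEquiv.apply_symm_apply v).symm
    have hd : ∀ g, TensorProduct.map η.toLinearMap η.toLinearMap (D₁.defect g) =
        D₂.defect (φ g) := fun g => by
      have hcomm : TensorProduct.map η.toLinearMap η.toLinearMap ∘ₗ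
          TensorProduct.map (D₁.ρ g⁻¹) (D₁.ρ g⁻¹) =
          TensorProduct.map (D₂.ρ (φ g)⁻¹) (D₂.ρ (φ g)⁻¹) ∘ₗ
            TensorProduct.map η.toLinearMap η.toLinearMap := by
        ext v w
        simp only [← map_inv]
        exact congrArg₂ (· ⊗ₜ[ℂ] ·) (heq g⁻¹ v) (heq g⁻¹ w)
      have h := hB (φ g)⁻¹
      rw [map_sub] at h
      rw [TwistDatum.defect, TwistDatum.defect, map_sub, ← LinearMap.comp_apply, hcomm,
        LinearMap.comp_apply, sub_eq_sub_iff_sub_eq_sub]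
      exact h.symm
    let A : D₁.Alg ≃ₐ[ℂ] D₂.Alg := AlgEquiv.ofAlgHom
      (TwistDatum.mapAlg φ.toMonoidHom η.toLinearMap heq)
      (TwistDatum.mapAlg φ.symm.toMonoidHom η.toLinearEquiv.symm.toLinearMap heq')
      (D₂.algHom_ext (fun g => by simp [TwistDatum.mapAlg_gr]) (fun v => by
        refine (congrArg _ (TwistDatum.mapAlg_vec _ _ heq' v)).trans
          ((TwistDatum.mapAlg_vec _ _ heq _).trans ?_)
        exact congrArg D₂.vec (η.toLinearEquiv.apply_symm_apply v)))
      (D₁.algHom_ext (fun g => by simp [TwistDatum.mapAlg_gr]) (fun v => by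
        refine (congrArg _ (TwistDatum.mapAlg_vec _ _ heq v)).trans
          ((TwistDatum.mapAlg_vec _ _ heq' _).trans ?_)
        exact congrArg D₁.vec (η.toLinearEquiv.symm_apply_apply v)))
    exact ⟨BialgEquiv.ofAlgEquiv A (TwistDatum.hopfCounit_mapAlg _ _ heq)
      (TwistDatum.map_mapAlg_comul _ _ heq hu hd)⟩
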